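/- **Conventions.** A *protorootoid* $\mathcal R=(G,\Lambda,N)$ is a groupoid $G$, a functor $\Lambda$ from $G$ to (not necessarily unital) Boolean rings, and a cocycle $N$, i.e. $N(g)\in\Lambda(a)$ for $g\in{}_aG$ (the set of morphisms with codomain $a$) and $N(gh)=N(g)+gN(h)$. The weak right preorder on ${}_aG$ is $x\le y\iff N(x)\subseteq N(y)$, where inclusion in a Boolean ring means $N(x)N(y)=N(x)$. $\mathcal R$ is *faithful* if $N(g)=0$ only for identity morphisms $g$. A *rootoid* is a faithful protorootoid such that in each ${}_aG$ every non-empty subset has a meet, and $N(x_i)\cap N(y)=\emptyset$ for all $i$ implies $N(\bigvee_i x_i)\cap N(y)=\emptyset$ whenever the join $\bigvee_i x_i$ exists. A protorootoid is *preprincipal* if it is faithful, all intervals of its weak right orders are finite, and for each atom $r$ of ${}_aG$ and each $g\in{}_aG$ either $N(r)\subseteq N(g)$ or $N(r)\cap N(g)=\emptyset$; its *atomic generators* are the atoms of its weak right orders. A morphism of protorootoids $(H,\Lambda',N')\to(G,\Lambda,N)$ is a groupoid homomorphism $\theta\colon H\to G$ with a natural transformation $\nu\colon\Lambda'\to\Lambda\theta$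 such that $\nu(N'(h))=N(\theta(h))$; $\theta^\perp(w):=\min\{u\in{}_aH: w\le\theta(u)\}$ (for $w\in{}_{\theta(a)}G$) is defined on the order ideal generated by $\theta({}_aH)$. A morphism between rootoids is *in $\mathbf{Rd}$* if each map ${}_aH\to{}_{\theta(a)}G$ preserves meets of non-empty subsets and all existing joins, and the *adjunction orthogonality property* (AOP) holds: $N(\theta(x))\cap N(w)=\emptyset$ implies $N'(x)\cap N'(\theta^\perp(w))=\emptyset$ whenever $\theta^\perp(w)$ is defined. It is *in $\mathbf{RdE}$* if moreover each ${}_aH\to{}_{\theta(a)}G$ is an order embedding whose image is join-closed (the join in ${}_{\theta(a)}G$ of a subset of the image, if it exists, lies in the image). For a Coxeter system $(W,S)$ with length function $\ell$ and set of reflections $T$, let $\mathcal C_{(W,S)}=(W,\wp(T),N)$, where $W$ is a one-object groupoid acting on $\wp(T)$ by conjugation and $N(w)=\{t\in T:\ell(tw)<\ell(w)\}$. **Proposition.** Let $(W,S)$ be a Coxeter system (of arbitrary rank), let $G$ be a group of automorphisms of the group $W$ each of which maps $S$ onto $S$, let $W'=W^G$ be the fixed subgroup and $i\colon W'\to W$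 the inclusion. Let $\mathcal R=\mathcal C_{(W,S)}$, let $\mathcal T=\mathcal R_{W'}=(W',\wp(T),N\circ i)$ be its restriction to $W'$, and $i^\flat\colon\mathcal T\to\mathcal R$ the canonical morphism. Let $S'$ be the set of longest elements $w_J$ of the finite standard parabolic subgroups $W_J$ such that $J$ is a single $G$-orbit on $S$. Let $I$ be the order ideal of $W$ generated by $W'$ in weak right order. Then: 1. $\mathcal T$ is a preprincipal rootoid, and $i^\flat$ is a morphism in $\mathbf{RdE}$; in particular it satisfies the AOP. 2. For each $w\in I$, $i^\perp(w)$ is defined, the join $\bigvee_{\sigma\in G}\sigma(w)$ exists in $W$, and $i^\perp(w)=\bigvee_{\sigma\in G}\sigma(w)$. 3. The set of atomic generators of $\mathcal T$ is $\{i^\perp(s): s\in S\cap I\}$, and it is equal to $S'$. 4. (Tits) $(W',S')$ is a Coxeter system. -/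

import Mathlib

namespace CoxeterSystem

variable {B W : Type*} [Group W] {M : CoxeterMatrix B} (cs : CoxeterSystem M W)

open Classical in
/-- The permutation `(t, ε) ↦ (s t s, ε + [t = s])` of `W × ℤ/2` attached to a simple `s`. -/
noncomputable def signedConj (i : B) : Equiv.Perm (W × ZMod 2) :=
  Function.Involutive.toPerm
    (fun p => (cs.simple i * p.1 * cs.simple i, p.2 + if p.1 = cs.simple i then 1 else 0)) (by
      rintro ⟨t, e⟩
      have h : cs.simple i * t * cs.simple i = cs.simple i ↔ t = cs.simple i := by
        rw [mul_assoc, mul_eq_left, mul_eq_one_iff_eq_inv, cs.inv_simple]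
      simp only [h, Prod.mk.injEq]
      refine ⟨by simp [mul_assoc], ?_⟩
      rw [add_assoc, CharTwo.add_self_eq_zero, add_zero])

open Classical in
theorem signedConj_word (ω : List B) (t : W) (e : ZMod 2) :
    (ω.map cs.signedConj).prod (t, e) =
      (cs.wordProd ω * t * (cs.wordProd ω)⁻¹, e + (cs.rightInvSeq ω).count t) := by
  induction ω with
  | nil => simp
  | cons i ω ih =>
    rw [List.map_cons, List.prod_cons, Equiv.Perm.mul_apply, ih]
    have h : cs.wordProd ω * t * (cs.wordProd ω)⁻¹ = cs.simple i ↔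
        (cs.wordProd ω)⁻¹ * cs.simple i * cs.wordProd ω = t := by
      constructor
      · intro h; rw [← h]; group
      · intro h; rw [← h]; group
    have happ : ∀ p : W × ZMod 2, cs.signedConj i p =
        (cs.simple i * p.1 * cs.simple i, p.2 + if p.1 = cs.simple i then 1 else 0) :=
      fun _ => rfl
    rw [happ]
    refine Prod.ext ?_ ?_
    · simp [wordProd_cons, mul_assoc]
    · simp only [h, rightInvSeq, List.count_cons, beq_iff_eq]
      push_cast
      rw [add_assoc]

theorem signedConj_liftable : M.IsLiftable cs.signedConj := by
  classical
  intro i j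
  have key : ∀ p : ℕ, ((alternatingWord i j (2 * p)).map cs.signedConj).prod
      = (cs.signedConj i * cs.signedConj j) ^ p := by
    intro p
    induction p with
    | zero => simp [alternatingWord]
    | succ p ih =>
      rw [show 2 * (p + 1) = 2 * p + 1 + 1 by ring, alternatingWord_succ', alternatingWord_succ']
      simp [ih, pow_succ', mul_assoc]
  have hinv : ∀ ω : List B, (ω.reverse.map cs.signedConj).prod =
      ((ω.map cs.signedConj).prod)⁻¹ := by
    intro ω
    induction ω with
    | nil => simp
    | cons k ω ih =>
      have : (cs.signedConj k)⁻¹ = cs.signedConj k := rfl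
      rw [List.reverse_cons, List.map_append, List.prod_append, ih]
      simp [this]
  have hlis : cs.leftInvSeq (alternatingWord i j (2 * M i j)) =
      (List.range (2 * M i j)).map (fun k => cs.simple i * (cs.simple j * cs.simple i) ^ k) := by
    apply List.ext_getElem
    · simp
    · intro k h1 h2
      have hk : k < 2 * M i j := by simpa using h1
      rw [cs.getElem_leftInvSeq_alternatingWord i j (M i j) k hk, prod_alternatingWord_eq_mul_pow]
      have : ¬ Even (2 * k + 1) := by simp
      have h3 : (2 * k + 1) / 2 = k := by omega
      simp [h3]
  rw [← key, ← inv_inv ((List.map _ _).prod), ← hinv, inv_eq_one]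
  ext1 ⟨t, e⟩
  rw [signedConj_word, rightInvSeq_reverse, List.count_reverse, hlis, two_mul, List.range_add,
    List.map_append, List.count_append, List.map_map]
  have hper : (fun k => cs.simple i * (cs.simple j * cs.simple i) ^ k) ∘ (fun x => M i j + x) =
      (fun k => cs.simple i * (cs.simple j * cs.simple i) ^ k) := by
    funext k
    simp [pow_add]
  rw [hper, Nat.cast_add, CharTwo.add_self_eq_zero (_ : ZMod 2), wordProd_reverse, ← two_mul,
    prod_alternatingWord_eq_mul_pow]
  simp

/-- The action of `W` on `W × ℤ/2` by signed conjugation. -/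
noncomputable def signedConjHom : W →* Equiv.Perm (W × ZMod 2) :=
  cs.lift ⟨cs.signedConj, cs.signedConj_liftable⟩

open Classical in
theorem signedConjHom_word (ω : List B) (t : W) (e : ZMod 2) :
    cs.signedConjHom (cs.wordProd ω) (t, e) =
      (cs.wordProd ω * t * (cs.wordProd ω)⁻¹, e + (cs.rightInvSeq ω).count t) := by
  rw [← signedConj_word]
  congr 1
  simp only [wordProd, map_list_prod, List.map_map]
  congr 2
  funext i
  simp [signedConjHom]

theorem signedConjHom_apply (w t : W) (e : ZMod 2) :
    cs.signedConjHom w (t, e) = (w * t * w⁻¹, e + (cs.signedConjHom w (t, 0)).2) := by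
  classical
  obtain ⟨ω, rfl⟩ := cs.wordProd_surjective w
  simp [signedConjHom_word]

theorem signedConjHom_reflection {t : W} (ht : cs.IsReflection t) :
    (cs.signedConjHom t (t, 0)).2 = 1 := by
  classical
  obtain ⟨w, i, rfl⟩ := ht
  have h1 : cs.signedConjHom w⁻¹ (w * cs.simple i * w⁻¹, 0) =
      (cs.simple i, (cs.signedConjHom w⁻¹ (w * cs.simple i * w⁻¹, 0)).2) := by
    rw [signedConjHom_apply]; simp [mul_assoc]
  set e := (cs.signedConjHom w⁻¹ (w * cs.simple i * w⁻¹, 0)).2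
  have h2 : cs.signedConjHom (cs.simple i) (cs.simple i, e) = (cs.simple i, e + 1) := by
    have := cs.signedConjHom_word [i] (cs.simple i) e
    simpa [rightInvSeq] using this
  have h3 : cs.signedConjHom w (cs.simple i, e) = (w * cs.simple i * w⁻¹, 0) := by
    rw [← h1, ← Equiv.Perm.mul_apply, ← map_mul]; simp
  have h4 : e + (cs.signedConjHom w (cs.simple i, 0)).2 = 0 := by
    rw [signedConjHom_apply] at h3
    exact (Prod.mk.inj h3).2
  rw [map_mul, map_mul, Equiv.Perm.mul_apply, Equiv.Perm.mul_apply, h1, h2, signedConjHom_apply]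
  linear_combination h4

theorem signedConjHom_eq_one_of {w t : W} (h : (cs.signedConjHom w⁻¹ (t, 0)).2 ≠ 0) :
    cs.IsLeftInversion w t := by
  classical
  obtain ⟨ω, hω, rfl⟩ := cs.exists_isReduced w
  rw [← wordProd_reverse, signedConjHom_word, rightInvSeq_reverse, List.count_reverse] at h
  apply cs.isLeftInversion_of_mem_leftInvSeq hω
  by_contra hn
  exact h (by simp [List.count_eq_zero_of_not_mem hn])

/-- A reflection `t` shortens `w` from the left iff the sign at `t` is switched by `w⁻¹`. -/
theorem isLeftInversion_iff_signedConjHom {w t : W} (ht : cs.IsReflection t) :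
    cs.IsLeftInversion w t ↔ (cs.signedConjHom w⁻¹ (t, 0)).2 = 1 := by
  have dich : ∀ x : ZMod 2, x ≠ 0 → x = 1 := by decide
  refine ⟨fun h => ?_, fun h => cs.signedConjHom_eq_one_of (by rw [h]; decide)⟩
  by_contra hn
  have h0 : (cs.signedConjHom w⁻¹ (t, 0)).2 = 0 := by
    by_contra h'; exact hn (dich _ h')
  have h1 : cs.IsLeftInversion (t * w) t := by
    apply cs.signedConjHom_eq_one_of
    have e1 : cs.signedConjHom t (t, 0) = (t, 1) := by
      have := cs.signedConjHom_reflection ht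
      rw [signedConjHom_apply] at this ⊢
      simpa using this
    rw [mul_inv_rev, ht.inv, map_mul, Equiv.Perm.mul_apply, e1, signedConjHom_apply, h0]
    simp
  have h2 := h1.2
  rw [← mul_assoc, ht.mul_self, one_mul] at h2
  exact absurd h.2 (by omega)

theorem isLeftInversion_mul_iff {x y t : W} (ht : cs.IsReflection t) :
    cs.IsLeftInversion (x * y) t ↔
      Xor (cs.IsLeftInversion x t) (cs.IsLeftInversion y (x⁻¹ * t * x)) := by
  have ht' : cs.IsReflection (x⁻¹ * t * x) := by simpa using ht.conj x⁻¹
  have tot : ∀ a b : ZMod 2, a + b = 1 ↔ Xor (a = 1) (b = 1) := by unfold Xor; decide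
  rw [cs.isLeftInversion_iff_signedConjHom ht, cs.isLeftInversion_iff_signedConjHom ht,
    cs.isLeftInversion_iff_signedConjHom ht', mul_inv_rev, map_mul, Equiv.Perm.mul_apply,
    cs.signedConjHom_apply x⁻¹, cs.signedConjHom_apply y⁻¹]
  simp [tot]

end CoxeterSystem

open CategoryTheory

universe w v u w' v' u'

/-- A protorootoid with underlying groupoid `G`: a functor `Λ` from `G` to (not necessarily unital)
Boolean rings, together with a 1-cocycle `N` of `G` with values in `Λ`. A morphism `b ⟶ a` of the
category `G` is an element of `ₐG_b`, and the product `g h` of `g : b ⟶ a` and `h : c ⟶ b` is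
`h ≫ g`. -/
structure Protorootoid (G : Type u) [Groupoid.{v} G] where
  /-- the Boolean ring attached to an object -/
  Λ : G → Type w
  [ring : ∀ a, NonUnitalRing (Λ a)]
  mul_self : ∀ (a : G) (x : Λ a), x * x = x
  /-- the homomorphism of Boolean rings attached to a morphism -/
  act : ∀ {a b : G}, (b ⟶ a) → (Λ b →ₙ+* Λ a)
  act_id : ∀ (a : G) (x : Λ a), act (𝟙 a) x = x
  act_comp : ∀ {a b c : G} (g : b ⟶ a) (h : c ⟶ b) (x : Λ c), act (h ≫ g) x = act g (act h x)
  /-- the cocycle -/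
  N : ∀ {a b : G}, (b ⟶ a) → Λ a
  cocycle : ∀ {a b c : G} (g : b ⟶ a) (h : c ⟶ b), N (h ≫ g) = N g + act g (N h)

namespace Protorootoid

attribute [instance] Protorootoid.ring

section WeakOrder

variable {G : Type u} [Groupoid.{v} G] (R : Protorootoid.{w} G)

theorem N_id (a : G) : R.N (𝟙 a) = 0 := by
  have h := R.cocycle (𝟙 a) (𝟙 a)
  rw [R.act_id, Category.comp_id] at h
  simpa using h

/-- The star `ₐG`, that is, the set of all morphisms with codomain `a`. -/
def Star (_R : Protorootoid.{w} G) (a : G) : Type (max u v) := Σ b : G, (b ⟶ a)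

/-- A morphism with codomain `a`, as an element of the star at `a`. -/
def toStar {a b : G} (g : b ⟶ a) : R.Star a := ⟨b, g⟩

variable {R}

/-- The value `N g ∈ Λ a` of the cocycle at an element `g` of the star `ₐG`. -/
def Star.N {a : G} (x : R.Star a) : R.Λ a := R.N x.2

/-- The weak right preorder on `ₐG`: `x ≤ y` iff `N x ⊆ N y`, where inclusion in a Boolean ring
means `N x * N y = N x`. -/
instance (a : G) : Preorder (R.Star a) where
  le x y := x.N * y.N = x.N
  le_refl x := R.mul_self a x.N
  le_trans x y z hxy hyz := by
    change x.N * y.N = x.N at hxy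
    change y.N * z.N = y.N at hyz
    rw [← hxy, mul_assoc, hyz]

instance (a : G) : OrderBot (R.Star a) where
  bot := ⟨a, 𝟙 a⟩
  bot_le x := by
    change R.N (𝟙 a) * _ = R.N (𝟙 a)
    rw [R.N_id, zero_mul]

variable (R)

/-- `R` is faithful if only identity morphisms `g` have `N g = 0`; equivalently, all weak right
preorders are partial orders. -/
def IsFaithful : Prop := ∀ (a : G) (x : R.Star a), x.N = 0 → x = ⊥

/-- Join orthogonality property: an element which is orthogonal to (has disjoint `N` from) each
member of a family is orthogonal to the join of the family, if that join exists. -/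
def JOP : Prop := ∀ (a : G) (X : Set (R.Star a)) (x y : R.Star a),
  IsLUB X x → (∀ z ∈ X, z.N * y.N = 0) → x.N * y.N = 0

/-- A rootoid: a faithful protorootoid whose weak right orders are complete meet semilattices (each
non-empty subset has a meet) and which satisfies the join orthogonality property. -/
structure IsRootoid : Prop where
  faithful : R.IsFaithful
  exists_meet : ∀ (a : G) (X : Set (R.Star a)), X.Nonempty → ∃ x, IsGLB X x
  jop : R.JOP

/-- All closed intervals of all weak right orders are finite. -/
def IsIntervalFinite : Prop := ∀ (a : G) (x y : R.Star a), (Set.Icc x y).Finite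

/-- The atomic morphisms `r : b ⟶ a`: the atoms of the weak right order on `ₐG`. -/
def IsAtomic {a b : G} (r : b ⟶ a) : Prop := IsAtom (R.toStar r)

/-- Preprincipal protorootoids: faithful, interval finite, and for each atomic `r ∈ ₐG` and each
`g ∈ ₐG`, either `N r ⊆ N g` or `N r ∩ N g = ∅`. -/
structure IsPreprincipal : Prop where
  faithful : R.IsFaithful
  intervalFinite : R.IsIntervalFinite
  le_or_orthogonal : ∀ {a b : G} (r : b ⟶ a), R.IsAtomic r →
    ∀ g : R.Star a, R.toStar r ≤ g ∨ R.N r * g.N = 0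

end WeakOrder

section Morphisms

variable {G : Type u} [Groupoid.{v} G] {H : Type u'} [Groupoid.{v'} H]

/-- Morphisms of protorootoids: a functor of the underlying groupoids and a natural transformation
of the functors to Boolean rings which is compatible with the cocycles. -/
structure Hom (T : Protorootoid.{w} H) (R : Protorootoid.{w'} G) where
  /-- the functor of underlying groupoids -/
  functor : H ⥤ G
  /-- the components of the natural transformation -/
  ringHom : ∀ a : H, T.Λ a →ₙ+* R.Λ (functor.obj a)
  natural : ∀ {a b : H} (g : b ⟶ a) (x : T.Λ b),
    ringHom _ (T.act g x) = R.act (functor.map g) (ringHom b x)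
  map_N : ∀ {a b : H} (g : b ⟶ a), ringHom a (T.N g) = R.N (functor.map g)

/-- The pullback protorootoid `θ♮ R` along a groupoid homomorphism `θ`. -/
@[simps] def pullback (R : Protorootoid.{w} G) (θ : H ⥤ G) : Protorootoid.{w} H where
  Λ a := R.Λ (θ.obj a)
  mul_self a := R.mul_self (θ.obj a)
  act g := R.act (θ.map g)
  act_id a x := by rw [θ.map_id, R.act_id]
  act_comp g h x := by rw [θ.map_comp, R.act_comp]
  N g := R.N (θ.map g)
  cocycle g h := by rw [θ.map_comp, R.cocycle]

/-- The canonical morphism `θ♭ : θ♮ R → R`. -/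
@[simps] def pullbackHom (R : Protorootoid.{w} G) (θ : H ⥤ G) : Hom (R.pullback θ) R where
  functor := θ
  ringHom _ := NonUnitalRingHom.id _
  natural _ _ := rfl
  map_N _ := rfl

namespace Hom

variable {T : Protorootoid.{w} H} {R : Protorootoid.{w'} G} (f : Hom T R)

/-- The map induced by a morphism from the star at `a` to the star at the image of `a`. -/
def star {a : H} (x : T.Star a) : R.Star (f.functor.obj a) :=
  ⟨f.functor.obj x.1, f.functor.map x.2⟩

/-- `f.IsPerp w u` says that the partially defined adjoint `f^⊥` at `a` is defined at `w`, with
value `u`: that is, `u` is the minimum element of `ₐH` whose image is at least `w`. -/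
def IsPerp {a : H} (w : R.Star (f.functor.obj a)) (u : T.Star a) : Prop :=
  IsLeast {v : T.Star a | w ≤ f.star v} u

/-- Adjunction orthogonality property: if `f^⊥ w` is defined and `w` is orthogonal to the image of
`x`, then `f^⊥ w` is orthogonal to `x`. -/
def AOP : Prop := ∀ (a : H) (x u : T.Star a) (w : R.Star (f.functor.obj a)),
  f.IsPerp w u → (f.star x).N * w.N = 0 → x.N * u.N = 0

/-- Morphisms of the category `Rd`: morphisms of protorootoids between rootoids such that the
induced maps of weak right orders preserve all meets of non-empty subsets and all joins which exist,
and which have the adjunction orthogonality property. -/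
structure IsRd : Prop where
  source : T.IsRootoid
  target : R.IsRootoid
  map_meet : ∀ (a : H) (X : Set (T.Star a)) (x : T.Star a), X.Nonempty → IsGLB X x →
    IsGLB (f.star '' X) (f.star x)
  map_join : ∀ (a : H) (X : Set (T.Star a)) (x : T.Star a), IsLUB X x →
    IsLUB (f.star '' X) (f.star x)
  aop : f.AOP

/-- Morphisms of the category `RdE` (rootoid local embeddings): morphisms of `Rd` such that the
induced maps of weak right orders are order embeddings onto join-closed subsets: if the join of a
set of elements of the image exists in the codomain, it belongs to the image. -/
structure IsRdE : Prop extends f.IsRd where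
  le_iff : ∀ (a : H) (x y : T.Star a), f.star x ≤ f.star y ↔ x ≤ y
  injective : ∀ a : H, Function.Injective (f.star (a := a))
  join_closed : ∀ (a : H) (X : Set (T.Star a)) (y : R.Star (f.functor.obj a)),
    IsLUB (f.star '' X) y → ∃ x, f.star x = y

end Hom

end Morphisms

section Groups

variable {W : Type u} [Group W]

/-- An element of a group, as an element of the star at the only object of the group, regarded as
one-object groupoid. -/
def elt (R : Protorootoid.{w} (SingleObj W)) (x : W) : R.Star (SingleObj.star W) :=
  R.toStar (b := SingleObj.star W) x

/-- The set of atomic generators of a protorootoid whose underlying groupoid is a group. -/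
def atomicGenerators (R : Protorootoid.{w} (SingleObj W)) : Set W :=
  {x | R.IsAtomic (a := SingleObj.star W) (b := SingleObj.star W) x}

end Groups

end Protorootoid

namespace CoxeterSystem

variable {B W : Type*} [Group W] {M : CoxeterMatrix B} (cs : CoxeterSystem M W)

/-- The set `T` of reflections of a Coxeter system. -/
abbrev Reflections : Type _ := {t : W // cs.IsReflection t}

/-- Conjugation of sets of reflections by `w`, as a homomorphism of Boolean rings; a reflection `t`
is in the image `w A w⁻¹` of `A` if and only if `w⁻¹ t w` is in `A`. -/
def conjReflections (w : W) : AsBoolRing (Set cs.Reflections) →ₙ+* AsBoolRing (Set cs.Reflections)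
    where
  toFun A := toBoolRing {t | (⟨w⁻¹ * t * w, by simpa using t.2.conj w⁻¹⟩ : cs.Reflections) ∈
    ofBoolRing A}
  map_mul' _ _ := rfl
  map_zero' := rfl
  map_add' _ _ := rfl

/-- `N(w) = {t ∈ T | ℓ(t w) < ℓ(w)}`. -/
def inversionSet (w : W) : Set cs.Reflections := {t | cs.length (t * w) < cs.length w}

/-- The standard protorootoid `(W, ℘(T), N)` of a Coxeter system: the group `W` as one-object
groupoid acts by conjugation on the Boolean ring of subsets of the set `T` of reflections, and `N`
is the reflection cocycle. -/
def standardProtorootoid : Protorootoid (SingleObj W) where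
  Λ _ := AsBoolRing (Set cs.Reflections)
  mul_self _ x := inf_idem (ofBoolRing x)
  act w := cs.conjReflections w
  act_id _ x := by
    refine congrArg toBoolRing (Set.ext fun t => ?_)
    have h : (⟨(1 : W)⁻¹ * t * 1, by simpa using t.2⟩ : cs.Reflections) = t :=
      Subtype.ext (by simp)
    exact iff_of_eq (congrArg (· ∈ ofBoolRing x) h)
  act_comp {_ _ _} (g h : W) x := by
    refine congrArg toBoolRing (Set.ext fun t => ?_)
    have e : (⟨(g * h)⁻¹ * t * (g * h), by simpa using t.2.conj (g * h)⁻¹⟩ : cs.Reflections) =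
        ⟨h⁻¹ * (g⁻¹ * t * g) * h, by simpa using (t.2.conj g⁻¹).conj h⁻¹⟩ :=
      Subtype.ext (by simp [mul_assoc])
    exact iff_of_eq (congrArg (· ∈ ofBoolRing x) e)
  N w := toBoolRing (cs.inversionSet w)
  cocycle {_ _ _} (g h : W) := by
    refine congrArg toBoolRing (Set.ext fun t => ?_)
    have h0 := cs.isLeftInversion_mul_iff (x := g) (y := h) t.2
    have h1 : cs.IsReflection (g⁻¹ * t * g) := by simpa using t.2.conj g⁻¹
    simp only [IsLeftInversion, t.2, h1, true_and] at h0
    exact h0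

/-- An automorphism of the Coxeter system `(W, S)` (a diagram automorphism): an automorphism of the
group `W` which maps the set `S` of simple generators onto itself. -/
def IsDiagramAut (σ : MulAut W) : Prop := σ '' Set.range cs.simple = Set.range cs.simple

/-- The set of longest elements `w_J` of the finite standard parabolic subgroups `W_J` of `W` such
that `J` is a single orbit of `G` on the set of simple generators. -/
def orbitLongestElements (G : Subgroup (MulAut W)) : Set W :=
  {w | ∃ s ∈ Set.range cs.simple,
    (Subgroup.closure (MulAction.orbit G s) : Set W).Finite ∧
    w ∈ Subgroup.closure (MulAction.orbit G s) ∧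
    ∀ v ∈ Subgroup.closure (MulAction.orbit G s), cs.length v ≤ cs.length w}

end CoxeterSystem

namespace Protorootoid

/-- The restriction of a protorootoid of a group to a subgroup `H`: the pullback along the inclusion
of `H`. -/
abbrev restrict {W : Type u} [Group W] (R : Protorootoid.{w} (SingleObj W)) (H : Subgroup W) :
    Protorootoid.{w} (SingleObj H) :=
  R.pullback H.subtype.toFunctor

/-- The canonical morphism `i♭` from the restriction to a subgroup `H`, where `i` is the inclusion
of `H`. -/
abbrev restrictHom {W : Type u} [Group W] (R : Protorootoid.{w} (SingleObj W)) (H : Subgroup W) :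
    Hom (R.restrict H) R :=
  R.pullbackHom H.subtype.toFunctor

end Protorootoid

/-!
# Fixed points of diagram automorphisms of Coxeter groups

Everything is expressed by the sets `cs.inversions w`: they have `ℓ w` elements and determine `w`,
and both inclusion and disjointness of two such sets are visible in the length of `x⁻¹ y`.

The weak order of `W` is a complete meet semilattice. For two covers `z s`, `z s'` of `z` with an
upper bound, the standard parabolic subgroup `W_J` with `J = {s, s'}` has a longest element `w_J`,
and `z w_J` is the join (`exists_join_covers`); the argument of Björner, Edelman and Ziegler passes
to arbitrary bounded pairs (`exists_join_pair_of_le`). The parabolic facts come from the lifting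
property of Bruhat order: if all, or none, of the elements of `J` are inversions of `v`, the same
holds for all reflections in `W_J`. In the rank two case one sees that a simple reflection which is
an inversion of a join is an inversion of one of the joined elements, and an induction on the length
extends this to the join orthogonality property (`disjoint_join`).

Diagram automorphisms are automorphisms of the weak order, so that meets and joins of sets of fixed
points are fixed points. The adjoint of the inclusion of the fixed subgroup sends `w` to the join of
its orbit, and the adjunction orthogonality property is join orthogonality for this join. Again by
join orthogonality, a fixed point is above the join of an orbit of simple reflections or orthogonal
to it (`IsJoin.subset_or_disjoint`); so these joins, which are the longest elements `w_J` for finite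
`W_J`, are the atoms of the weak order on the fixed subgroup.

The theorem of Tits is deduced from a criterion (`exists_coxeterSystem`): a group `H` with a set `S`
of involutions and a suitable length function is a Coxeter group if cosets of `⟨r, r'⟩`, for `r` and
`r'` in `S`, have at most one element without descents in `{r, r'}`. Indeed, let `P` be the group
with the Coxeter presentation. The pairs `(r₁ ⋯ rₙ, r₁ ⋯ rₙ)` in `H × P` for length increasing
products of elements of `S` form the graph of a map `H → P`: two decompositions of an element that
begin with `r` and `r'` are compared through the minimal element of its coset under `⟨r, r'⟩`, where
only the relations of a dihedral group matter. This map is inverse to `P → H`. For the fixed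
subgroup, an element without descents `w_J` and `w_J'` is the minimal element of its coset under
`W_K`, where `K` is the union of `J` and `J'`.
-/

namespace CoxeterSystem

variable {B W : Type*} [Group W] {M : CoxeterMatrix B} (cs : CoxeterSystem M W)

/-! ### Inversion sets and weak order -/

/-- The left inversions of `w`, as a set of elements of `W`. Weak right
order is written as inclusion of these sets: `x ≤ y` iff `cs.inversions x ⊆ cs.inversions y`. -/
def inversions (w : W) : Set W := {t | cs.IsLeftInversion w t}

theorem mem_leftInvSeq_of_mem_inversions {ω : List B} {t : W}
    (h : t ∈ cs.inversions (cs.wordProd ω)) : t ∈ cs.leftInvSeq ω := by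
  classical
  have h1 := (cs.isLeftInversion_iff_signedConjHom h.1).1 h
  rw [← wordProd_reverse, signedConjHom_word, rightInvSeq_reverse, List.count_reverse] at h1
  by_contra hn
  simp [List.count_eq_zero_of_not_mem hn] at h1

theorem inversions_eq_leftInvSeq {ω : List B} (hω : cs.IsReduced ω) :
    cs.inversions (cs.wordProd ω) = {t | t ∈ cs.leftInvSeq ω} :=
  Set.ext fun _ => ⟨cs.mem_leftInvSeq_of_mem_inversions, cs.isLeftInversion_of_mem_leftInvSeq hω⟩

theorem finite_inversions (w : W) : (cs.inversions w).Finite := by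
  obtain ⟨ω, hω, rfl⟩ := cs.exists_isReduced w
  rw [inversions_eq_leftInvSeq _ hω]
  exact List.finite_toSet _

theorem ncard_inversions (w : W) : (cs.inversions w).ncard = cs.length w := by
  classical
  obtain ⟨ω, hω, rfl⟩ := cs.exists_isReduced w
  rw [inversions_eq_leftInvSeq _ hω, hω.eq]
  have : {t | t ∈ cs.leftInvSeq ω} = ((cs.leftInvSeq ω).toFinset : Set W) := by ext; simp
  rw [this, Set.ncard_coe_finset, List.toFinset_card_of_nodup hω.nodup_leftInvSeq,
    length_leftInvSeq]

theorem length_le_of_inversions_subset {x y : W} (h : cs.inversions x ⊆ cs.inversions y) :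
    cs.length x ≤ cs.length y := by
  rw [← ncard_inversions, ← ncard_inversions]
  exact Set.ncard_le_ncard h (cs.finite_inversions y)

@[simp] theorem inversions_one : cs.inversions 1 = ∅ := by
  rw [← Set.ncard_eq_zero (cs.finite_inversions 1), ncard_inversions, length_one]

theorem inversions_simple (i : B) : cs.inversions (cs.simple i) = {cs.simple i} := by
  have h : cs.IsReduced [i] := by simp [IsReduced]
  simpa using cs.inversions_eq_leftInvSeq h

theorem mem_inversions_mul {x y t : W} (ht : cs.IsReflection t) :
    t ∈ cs.inversions (x * y) ↔ Xor (t ∈ cs.inversions x) (x⁻¹ * t * x ∈ cs.inversions y) :=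
  cs.isLeftInversion_mul_iff ht

theorem conj_mem_inversions {x y t : W} (ht : cs.IsReflection t) :
    x⁻¹ * t * x ∈ cs.inversions (x⁻¹ * y) ↔
      Xor (t ∈ cs.inversions x) (t ∈ cs.inversions y) := by
  have h := cs.mem_inversions_mul (x := x) (y := x⁻¹ * y) ht
  rw [mul_inv_cancel_left] at h
  rw [h]
  unfold Xor
  tauto

theorem conj_mem_inversions_inv {x t : W} (ht : cs.IsReflection t) :
    x⁻¹ * t * x ∈ cs.inversions x⁻¹ ↔ t ∈ cs.inversions x := by
  have := cs.conj_mem_inversions (x := x) (y := 1) ht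
  simpa [Xor] using this

theorem inversions_inv_mul (x y : W) : cs.inversions (x⁻¹ * y) =
    (fun t => x⁻¹ * t * x) '' symmDiff (cs.inversions x) (cs.inversions y) := by
  ext t
  constructor
  · intro h
    have ht : cs.IsReflection (x * t * x⁻¹) := h.1.conj x
    refine ⟨x * t * x⁻¹, ?_, by group⟩
    have := cs.conj_mem_inversions (x := x) (y := y) ht
    rw [show x⁻¹ * (x * t * x⁻¹) * x = t by group] at this
    exact this.1 h
  · rintro ⟨t, ht, rfl⟩
    have hr : cs.IsReflection t := by rcases ht with h | h <;> exact h.1.1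
    exact (cs.conj_mem_inversions hr).2 ht

theorem length_inv_mul (x y : W) : cs.length (x⁻¹ * y) =
    (symmDiff (cs.inversions x) (cs.inversions y)).ncard := by
  rw [← ncard_inversions, inversions_inv_mul, Set.ncard_image_of_injective]
  intro a b h
  simpa using h

theorem length_inv_mul_of_disjoint {x y : W} (h : Disjoint (cs.inversions x) (cs.inversions y)) :
    cs.length (x⁻¹ * y) = cs.length x + cs.length y := by
  rw [length_inv_mul, h.symmDiff_eq_sup]
  change (cs.inversions x ∪ cs.inversions y).ncard = _
  rw [Set.ncard_union_eq h (cs.finite_inversions x) (cs.finite_inversions y), ncard_inversions,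
    ncard_inversions]

theorem length_inv_mul_of_subset {x y : W} (h : cs.inversions x ⊆ cs.inversions y) :
    cs.length (x⁻¹ * y) + cs.length x = cs.length y := by
  rw [length_inv_mul, symmDiff_of_le h, ← ncard_inversions, ← ncard_inversions]
  exact Set.ncard_sdiff_add_ncard_of_subset h (cs.finite_inversions y)

theorem inversions_injective : Function.Injective cs.inversions := by
  intro x y h
  have h1 := cs.length_inv_mul_of_subset h.subset
  have h2 := cs.length_le_of_inversions_subset h.symm.subset
  have h3 : cs.length (x⁻¹ * y) = 0 := by omega
  rwa [length_eq_zero_iff, inv_mul_eq_one] at h3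

theorem eq_of_subset_of_length_le {x y : W} (h : cs.inversions x ⊆ cs.inversions y)
    (hl : cs.length y ≤ cs.length x) : x = y := by
  have h1 := cs.length_inv_mul_of_subset h
  have h3 : cs.length (x⁻¹ * y) = 0 := by omega
  rwa [length_eq_zero_iff, inv_mul_eq_one] at h3

theorem exists_simple_mem_inversions {w : W} (hw : w ≠ 1) :
    ∃ i, cs.simple i ∈ cs.inversions w := by
  obtain ⟨i, hi⟩ := cs.exists_leftDescent_of_ne_one hw
  exact ⟨i, (cs.isLeftInversion_simple_iff_isLeftDescent w i).2 hi⟩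

/-- `z ≤ z d` in weak order iff lengths add in the product `z d`, expressed by inversion sets. -/
theorem subset_mul_iff {z d : W} :
    cs.inversions z ⊆ cs.inversions (z * d) ↔
      Disjoint (cs.inversions z⁻¹) (cs.inversions d) := by
  rw [Set.disjoint_left]
  constructor
  · intro h q hq hd
    have hr : cs.IsReflection (z * q * z⁻¹) := hq.1.conj z
    have e : z⁻¹ * (z * q * z⁻¹) * z = q := by group
    have h1 := cs.conj_mem_inversions_inv (x := z) hr
    have h2 := cs.mem_inversions_mul (x := z) (y := d) hr
    rw [e] at h1 h2
    have h3 := h2.1 (h (h1.1 hq))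
    unfold Xor at h3
    tauto
  · intro h t ht
    rw [cs.mem_inversions_mul ht.1]
    exact Or.inl ⟨ht, h ((cs.conj_mem_inversions_inv ht.1).2 ht)⟩

/-- If lengths add in `z d`, the elements above `z d` are the `y ≥ z` with `d ≤ z⁻¹ y`. -/
theorem mul_subset_iff {z d y : W} (hd : Disjoint (cs.inversions z⁻¹) (cs.inversions d)) :
    cs.inversions (z * d) ⊆ cs.inversions y ↔
      cs.inversions z ⊆ cs.inversions y ∧ cs.inversions d ⊆ cs.inversions (z⁻¹ * y) := by
  have hz := cs.subset_mul_iff.2 hd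
  rw [Set.disjoint_left] at hd
  constructor
  · intro h
    refine ⟨hz.trans h, fun q hq => ?_⟩
    have hr : cs.IsReflection (z * q * z⁻¹) := hq.1.conj z
    have e : z⁻¹ * (z * q * z⁻¹) * z = q := by group
    have h1 := cs.conj_mem_inversions_inv (x := z) hr
    have h2 := cs.mem_inversions_mul (x := z) (y := d) hr
    have h3 := cs.conj_mem_inversions (x := z) (y := y) hr
    rw [e] at h1 h2 h3
    have h4 := @h (z * q * z⁻¹)
    have h5 := @hd q
    unfold Xor at h2 h3
    tauto
  · rintro ⟨h1, h2⟩ t ht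
    by_cases htz : t ∈ cs.inversions z
    · exact h1 htz
    have h3 := (cs.mem_inversions_mul ht.1).1 ht
    have h4 := cs.conj_mem_inversions (x := z) (y := y) ht.1
    have h5 := @h2 (z⁻¹ * t * z)
    unfold Xor at h3 h4
    tauto

section Simple

variable {i : B} {x y t : W}

theorem simple_mem_inversions_simple_mul :
    cs.simple i ∈ cs.inversions (cs.simple i * x) ↔ cs.simple i ∉ cs.inversions x := by
  rw [cs.mem_inversions_mul (cs.isReflection_simple i), inversions_simple]
  simp [Xor]

theorem mem_inversions_simple_mul (ht : cs.IsReflection t) (hti : t ≠ cs.simple i) :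
    cs.simple i * t * cs.simple i ∈ cs.inversions (cs.simple i * x) ↔ t ∈ cs.inversions x := by
  have h := cs.conj_mem_inversions (x := cs.simple i) (y := x) ht
  rw [inversions_simple, inv_simple] at h
  simpa [Xor, hti] using h

theorem simple_mul_subset_iff (hx : cs.simple i ∉ cs.inversions x)
    (hy : cs.simple i ∈ cs.inversions y) :
    cs.inversions (cs.simple i * x) ⊆ cs.inversions y ↔
      cs.inversions x ⊆ cs.inversions (cs.simple i * y) := by
  have hd : Disjoint (cs.inversions (cs.simple i)⁻¹) (cs.inversions x) := by
    rw [inv_simple, inversions_simple]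
    simpa using hx
  rw [cs.mul_subset_iff hd, inversions_simple, Set.singleton_subset_iff, inv_simple]
  exact and_iff_right hy

theorem disjoint_simple_mul_iff (hx : cs.simple i ∉ cs.inversions x)
    (hy : cs.simple i ∈ cs.inversions y) :
    Disjoint (cs.inversions (cs.simple i * x)) (cs.inversions (cs.simple i * y)) ↔
      Disjoint (cs.inversions x) (cs.inversions y) := by
  have e : ∀ t, cs.simple i * (cs.simple i * t * cs.simple i) * cs.simple i = t := by
    intro t; simp [mul_assoc]
  rw [Set.disjoint_left, Set.disjoint_left]
  constructor
  · intro h t htx hty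
    have hti : t ≠ cs.simple i := fun h => hx (h ▸ htx)
    exact h ((cs.mem_inversions_simple_mul htx.1 hti).2 htx)
      ((cs.mem_inversions_simple_mul htx.1 hti).2 hty)
  · intro h t htx hty
    have hti : t ≠ cs.simple i := by
      rintro rfl
      exact cs.simple_mem_inversions_simple_mul.1 hty hy
    have h1 : ∀ z, t ∈ cs.inversions (cs.simple i * z) →
        cs.simple i * t * cs.simple i ∈ cs.inversions z := by
      intro z hz
      simpa using (cs.mem_inversions_simple_mul (x := cs.simple i * z) hz.1 hti).2 hz
    exact h (h1 x htx) (h1 y hty)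

end Simple

/-! ### Bruhat order and standard parabolic subgroups -/

/-- The Bruhat order: `x ≤ y` if `x` is obtained from `y` by a sequence of left multiplications by
reflections, each of which decreases the length. -/
def BruhatLE : W → W → Prop :=
  Relation.ReflTransGen fun x y => ∃ t, cs.IsReflection t ∧ y = t * x ∧ cs.length x < cs.length y

variable {cs} in
theorem BruhatLE.length_le {x y : W} (h : cs.BruhatLE x y) : cs.length x ≤ cs.length y := by
  induction h with
  | refl => exact le_rfl
  | tail _ h ih =>
    obtain ⟨t, -, -, h⟩ := h
    exact ih.trans h.le

variable {cs} in
/-- The lifting property of Bruhat order. -/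
theorem BruhatLE.lift {x y : W} (h : cs.BruhatLE x y) (i : B) :
    cs.BruhatLE (cs.simple i * x) (cs.simple i * y) ∨
      (cs.BruhatLE x (cs.simple i * y) ∧ cs.BruhatLE (cs.simple i * x) y) := by
  induction h with
  | refl => exact Or.inl .refl
  | @tail y z hxy hyz ih =>
    have hyz' := hyz
    obtain ⟨t, ht, rfl, hl⟩ := hyz
    by_cases hti : t = cs.simple i
    · subst hti
      rw [simple_mul_simple_cancel_left]
      refine Or.inr ⟨hxy, ?_⟩
      rcases ih with ih | ih
      · exact ih
      · exact ih.2.tail hyz'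
    · have h1 : t ∈ cs.inversions (t * y) := by
        refine ⟨ht, ?_⟩
        rwa [← mul_assoc, ht.mul_self, one_mul]
      have h2 := (cs.mem_inversions_simple_mul ht hti).2 h1
      have e : cs.simple i * t * cs.simple i * (cs.simple i * (t * y)) = cs.simple i * y := by
        rw [mul_assoc _ (cs.simple i), simple_mul_simple_cancel_left, mul_assoc _ t, ← mul_assoc t,
          ht.mul_self, one_mul]
      have h3 := h2.2
      rw [e] at h3
      have step : ∃ t', cs.IsReflection t' ∧ cs.simple i * (t * y) = t' * (cs.simple i * y) ∧
          cs.length (cs.simple i * y) < cs.length (cs.simple i * (t * y)) :=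
        ⟨_, h2.1, by simp [mul_assoc], h3⟩
      rcases ih with ih | ih
      · exact Or.inl (ih.tail step)
      · exact Or.inr ⟨ih.1.tail step, ih.2.tail hyz'⟩

theorem bruhatLE_simple_mul {i : B} {x : W} (h : cs.length x < cs.length (cs.simple i * x)) :
    cs.BruhatLE x (cs.simple i * x) :=
  .single ⟨_, cs.isReflection_simple i, rfl, h⟩

theorem bruhatLE_of_descent {i : B} {x : W} (h : cs.simple i ∈ cs.inversions x) :
    cs.BruhatLE (cs.simple i * x) x :=
  .single ⟨_, cs.isReflection_simple i, (cs.simple_mul_simple_cancel_left i).symm, h.2⟩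

variable {J : Set W} (hJ : J ⊆ Set.range cs.simple)
include hJ

theorem closure_simple_induction {p : W → Prop} (one : p 1)
    (mul : ∀ i d, cs.simple i ∈ J → d ∈ Subgroup.closure J → p d → p (cs.simple i * d)) {d : W}
    (hd : d ∈ Subgroup.closure J) : p d := by
  induction hd using Subgroup.closure_induction_left with
  | one => exact one
  | mul_left x hx y hy ih =>
    obtain ⟨i, rfl⟩ := hJ hx
    exact mul i y hx hy ih
  | inv_mul_cancel x hx y hy ih =>
    obtain ⟨i, rfl⟩ := hJ hx
    rw [inv_simple]
    exact mul i y hx hy ih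

/-- If all elements of `J` are inversions of `v` then so are all reflections in `W_J`: every
element of the coset `W_J v` is below `v` in Bruhat order. -/
theorem mem_inversions_of_closure {v : W} (hv : J ⊆ cs.inversions v) {t : W}
    (ht : cs.IsReflection t) (htJ : t ∈ Subgroup.closure J) : t ∈ cs.inversions v := by
  have key : ∀ d ∈ Subgroup.closure J, cs.BruhatLE (d * v) v := by
    intro d hd
    refine cs.closure_simple_induction hJ (p := fun d => cs.BruhatLE (d * v) v) ?_ ?_ hd
    · rw [one_mul]; exact .refl
    · intro i d hi _ ih
      rw [mul_assoc]
      rcases ih.lift i with h | h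
      · exact h.trans (cs.bruhatLE_of_descent (hv hi))
      · exact h.2
  refine ⟨ht, lt_of_le_of_ne (key t htJ).length_le (ht.length_mul_right_ne v)⟩

/-- If no element of `J` is an inversion of `v` then no element of `W_J` is one: `v` is below every
element of the coset `W_J v` in Bruhat order. -/
theorem notMem_inversions_of_closure {v : W} (hv : Disjoint J (cs.inversions v)) {t : W}
    (htJ : t ∈ Subgroup.closure J) : t ∉ cs.inversions v := by
  have key : ∀ d ∈ Subgroup.closure J, cs.BruhatLE v (d * v) := by
    intro d hd
    refine cs.closure_simple_induction hJ (p := fun d => cs.BruhatLE v (d * v)) ?_ ?_ hd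
    · rw [one_mul]; exact .refl
    · intro i d hi _ ih
      rw [mul_assoc]
      rcases ih.lift i with h | h
      · refine Relation.ReflTransGen.trans (cs.bruhatLE_simple_mul ?_) h
        by_contra hlt
        refine Set.disjoint_left.1 hv hi ⟨cs.isReflection_simple i, ?_⟩
        exact lt_of_le_of_ne (not_lt.1 hlt) (cs.length_simple_mul_ne v i)
      · exact h.1
  exact fun h => absurd (key t htJ).length_le (not_le.2 h.2)

theorem inversions_subset_closure {d : W} (hd : d ∈ Subgroup.closure J) :
    cs.inversions d ⊆ Subgroup.closure J := by
  refine cs.closure_simple_induction hJ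
    (p := fun d => cs.inversions d ⊆ Subgroup.closure J) (by simp) ?_ hd
  intro i d hi hd ih t ht
  have hiJ := Subgroup.subset_closure (k := J) hi
  rw [cs.mem_inversions_mul ht.1, inversions_simple] at ht
  rcases ht with ⟨h, -⟩ | ⟨h, -⟩
  · rw [Set.mem_singleton_iff.1 h]; exact hiJ
  · have h1 := ih h
    have h2 := mul_mem (mul_mem hiJ h1) (inv_mem hiJ)
    rwa [show cs.simple i * ((cs.simple i)⁻¹ * t * cs.simple i) * (cs.simple i)⁻¹ = t by group]
      at h2

theorem simple_mem_of_mem_closure {i : B} (hi : cs.simple i ∈ Subgroup.closure J) :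
    cs.simple i ∈ J := by
  by_contra hn
  refine cs.notMem_inversions_of_closure hJ (v := cs.simple i) ?_ hi ?_
  · rw [inversions_simple]; simpa using hn
  · rw [inversions_simple]; rfl

/-- The greatest element of `W_J` below `v` in weak order. -/
theorem exists_mem_closure_inversions_eq (v : W) :
    ∃ w ∈ Subgroup.closure J, cs.inversions w = cs.inversions v ∩ Subgroup.closure J := by
  obtain ⟨d, hd, hmin⟩ : ∃ d ∈ Subgroup.closure J, ∀ d' ∈ Subgroup.closure J,
      cs.length (d * v) ≤ cs.length (d' * v) := by
    obtain ⟨d, hd, h⟩ := (measure fun d => cs.length (d * v)).wf.has_min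
      (Subgroup.closure J : Set W) ⟨1, one_mem _⟩
    exact ⟨d, hd, fun d' hd' => not_lt.1 (h d' hd')⟩
  have hd' := inv_mem hd
  refine ⟨d⁻¹, hd', Set.ext fun t => ?_⟩
  have key : ∀ t ∈ Subgroup.closure J, t ∉ cs.inversions (d * v) := by
    intro t ht h
    have := hmin (t * d) (mul_mem ht hd)
    rw [mul_assoc] at this
    exact absurd h.2 (not_lt.2 this)
  constructor
  · intro ht
    have htJ := cs.inversions_subset_closure hJ hd' ht
    have h := cs.mem_inversions_mul (x := d⁻¹) (y := d * v) ht.1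
    rw [inv_mul_cancel_left] at h
    refine ⟨h.2 (Or.inl ⟨ht, key _ ?_⟩), htJ⟩
    exact mul_mem (mul_mem (inv_mem hd') htJ) hd'
  · rintro ⟨ht, htJ⟩
    have h := cs.mem_inversions_mul (x := d⁻¹) (y := d * v) ht.1
    rw [inv_mul_cancel_left] at h
    have h1 := key _ (mul_mem (mul_mem (inv_mem hd') htJ) hd')
    have h2 := h.1 ht
    unfold Xor at h2
    tauto

end CoxeterSystem

namespace CoxeterSystem

variable {B W : Type*} [Group W] {M : CoxeterMatrix B} (cs : CoxeterSystem M W)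

/-! ### Joins and meets in weak order -/

/-- `j` is the join of `X` in weak right order. -/
def IsJoin (X : Set W) (j : W) : Prop :=
  ∀ z, cs.inversions j ⊆ cs.inversions z ↔ ∀ x ∈ X, cs.inversions x ⊆ cs.inversions z

/-- `m` is the meet of `X` in weak right order. -/
def IsMeet (X : Set W) (m : W) : Prop :=
  ∀ z, cs.inversions z ⊆ cs.inversions m ↔ ∀ x ∈ X, cs.inversions z ⊆ cs.inversions x

variable {cs} in
theorem IsJoin.subset {X : Set W} {j x : W} (h : cs.IsJoin X j) (hx : x ∈ X) :
    cs.inversions x ⊆ cs.inversions j := (h j).1 subset_rfl x hx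

variable {cs} in
theorem IsJoin.unique {X : Set W} {j k : W} (hj : cs.IsJoin X j) (hk : cs.IsJoin X k) : j = k :=
  cs.inversions_injective (((hj k).2 fun _ hx => hk.subset hx).antisymm
    ((hk j).2 fun _ hx => hj.subset hx))

variable {cs} in
theorem IsMeet.subset {X : Set W} {m x : W} (h : cs.IsMeet X m) (hx : x ∈ X) :
    cs.inversions m ⊆ cs.inversions x := (h m).1 subset_rfl x hx

variable {cs} in
theorem IsMeet.unique {X : Set W} {j k : W} (hj : cs.IsMeet X j) (hk : cs.IsMeet X k) : j = k :=
  cs.inversions_injective (((hk j).2 fun _ hx => hj.subset hx).antisymm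
    ((hj k).2 fun _ hx => hk.subset hx))

/-- If `z < a` in weak order, some cover `z s` of `z` is at most `a`. -/
theorem exists_cover {z a : W} (h : cs.inversions z ⊆ cs.inversions a) (hne : z ≠ a) :
    ∃ i, cs.simple i ∉ cs.inversions z⁻¹ ∧ cs.simple i ∈ cs.inversions (z⁻¹ * a) := by
  obtain ⟨i, hi⟩ := cs.exists_simple_mem_inversions (w := z⁻¹ * a)
    fun h => hne (inv_mul_eq_one.1 h)
  have hd : Disjoint (cs.inversions z⁻¹) (cs.inversions (z⁻¹ * a)) := by
    rw [← subset_mul_iff, mul_inv_cancel_left]; exact h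
  exact ⟨i, fun h => Set.disjoint_left.1 hd h hi, hi⟩

section Cover

variable {z : W} {i : B} (hi : cs.simple i ∉ cs.inversions z⁻¹)
include hi

theorem disjoint_inversions_simple :
    Disjoint (cs.inversions z⁻¹) (cs.inversions (cs.simple i)) := by
  rw [inversions_simple]; simpa using hi

theorem cover_subset_iff {y : W} : cs.inversions (z * cs.simple i) ⊆ cs.inversions y ↔
    cs.inversions z ⊆ cs.inversions y ∧ cs.simple i ∈ cs.inversions (z⁻¹ * y) := by
  rw [cs.mul_subset_iff (cs.disjoint_inversions_simple hi), inversions_simple,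
    Set.singleton_subset_iff]

theorem length_cover : cs.length (z * cs.simple i) = cs.length z + 1 := by
  have := cs.length_inv_mul_of_disjoint (cs.disjoint_inversions_simple hi)
  simpa using this

end Cover

/-- Two covers `z s` and `z s'` of `z` with an upper bound have a join: it is `z w_J` where `w_J` is
the longest element of `W_J`, `J = {s, s'}`. A simple reflection which is an inversion of the join
is an inversion of one of the two covers. -/
theorem exists_join_covers {z u : W} {i j : B} (hi : cs.simple i ∉ cs.inversions z⁻¹)
    (hj : cs.simple j ∉ cs.inversions z⁻¹)
    (hiu : cs.inversions (z * cs.simple i) ⊆ cs.inversions u)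
    (hju : cs.inversions (z * cs.simple j) ⊆ cs.inversions u) :
    ∃ c, (∀ y, cs.inversions c ⊆ cs.inversions y ↔
        cs.inversions (z * cs.simple i) ⊆ cs.inversions y ∧
        cs.inversions (z * cs.simple j) ⊆ cs.inversions y) ∧
      ∀ k, cs.simple k ∉ cs.inversions (z * cs.simple i) →
        cs.simple k ∉ cs.inversions (z * cs.simple j) → cs.simple k ∉ cs.inversions c := by
  set J : Set W := {cs.simple i, cs.simple j} with hJdef
  have hJ : J ⊆ Set.range cs.simple := by
    rintro x (rfl | rfl) <;> exact Set.mem_range_self _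
  have hiJ : cs.simple i ∈ J := Or.inl rfl
  have hjJ : cs.simple j ∈ J := Or.inr rfl
  have hJz : Disjoint J (cs.inversions z⁻¹) := by
    rw [Set.disjoint_left]; rintro x (rfl | rfl) <;> assumption
  have hzJ : ∀ t ∈ Subgroup.closure J, t ∉ cs.inversions z⁻¹ :=
    fun t => cs.notMem_inversions_of_closure hJ hJz
  obtain ⟨w, hw, hwu⟩ := cs.exists_mem_closure_inversions_eq hJ (z⁻¹ * u)
  have hdisj : Disjoint (cs.inversions z⁻¹) (cs.inversions w) := by
    rw [Set.disjoint_right, hwu]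
    exact fun t ht => hzJ t ht.2
  have hJw : J ⊆ cs.inversions w := by
    rw [hwu]
    refine Set.subset_inter ?_ Subgroup.subset_closure
    rintro x (rfl | rfl)
    · exact ((cs.cover_subset_iff hi).1 hiu).2
    · exact ((cs.cover_subset_iff hj).1 hju).2
  refine ⟨z * w, fun y => ?_, fun k hki hkj hk => ?_⟩
  · rw [cs.mul_subset_iff hdisj, cs.cover_subset_iff hi, cs.cover_subset_iff hj]
    constructor
    · rintro ⟨h1, h2⟩
      exact ⟨⟨h1, h2 (hJw hiJ)⟩, h1, h2 (hJw hjJ)⟩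
    · rintro ⟨⟨h1, h2⟩, -, h3⟩
      refine ⟨h1, fun t ht => ?_⟩
      refine cs.mem_inversions_of_closure hJ ?_ ht.1 (cs.inversions_subset_closure hJ hw ht)
      rintro x (rfl | rfl) <;> assumption
  · -- otherwise `q = z⁻¹ s z` is a reflection in `W_J` with `s z = z q`, hence of length one
    have hkz : cs.simple k ∉ cs.inversions z := fun h =>
      hki (((cs.cover_subset_iff hi).1 subset_rfl).1 h)
    have hq : z⁻¹ * cs.simple k * z ∈ cs.inversions w := by
      rw [cs.mem_inversions_mul (cs.isReflection_simple k)] at hk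
      unfold Xor at hk
      tauto
    set q := z⁻¹ * cs.simple k * z with hqdef
    have hqJ := cs.inversions_subset_closure hJ hw hq
    have hqd : Disjoint (cs.inversions z⁻¹) (cs.inversions q) :=
      Set.disjoint_right.2 fun t ht => hzJ t (cs.inversions_subset_closure hJ hqJ ht)
    have hl := cs.length_inv_mul_of_disjoint hqd
    have hzq : z * q = cs.simple k * z := by rw [hqdef]; group
    rw [inv_inv, hzq, length_inv] at hl
    have hl1 : cs.length q = 1 := by
      have h0 : cs.length q ≠ 0 := fun h => by
        have := hq.1.odd_length
        rw [h] at this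
        simp at this
      have := cs.length_simple_mul z k
      omega
    obtain ⟨l, hl2⟩ := cs.length_eq_one_iff.1 hl1
    have hk' : cs.simple k ∈ cs.inversions (z * q) := by
      rw [hzq, simple_mem_inversions_simple_mul]; exact hkz
    rw [hl2] at hqJ hk'
    rcases cs.simple_mem_of_mem_closure hJ hqJ with h | h
    · exact hki (h ▸ hk')
    · exact hkj (h ▸ hk')

/-- Bounded pairs have joins, by induction on the length of an interval that contains them (the
argument of Björner, Edelman and Ziegler, which reduces joins to joins of two covers of one
element). -/
theorem exists_join_pair_of_le (n : ℕ) {z a b u : W} (hn : cs.length u ≤ cs.length z + n)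
    (hza : cs.inversions z ⊆ cs.inversions a) (hzb : cs.inversions z ⊆ cs.inversions b)
    (hau : cs.inversions a ⊆ cs.inversions u) (hbu : cs.inversions b ⊆ cs.inversions u) :
    ∃ c, (∀ y, cs.inversions c ⊆ cs.inversions y ↔
        cs.inversions a ⊆ cs.inversions y ∧ cs.inversions b ⊆ cs.inversions y) ∧
      ∀ k, cs.simple k ∉ cs.inversions a → cs.simple k ∉ cs.inversions b →
        cs.simple k ∉ cs.inversions c := by
  induction n generalizing z a b with
  | zero =>
    obtain rfl := cs.eq_of_subset_of_length_le (hza.trans hau) hn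
    have : a = b := cs.inversions_injective
      ((hau.trans hzb).antisymm (hbu.trans hza))
    subst this
    exact ⟨a, by simp, by tauto⟩
  | succ n ih =>
    by_cases hz1 : z = a
    · subst hz1
      exact ⟨b, fun y => ⟨fun h => ⟨hzb.trans h, h⟩, And.right⟩, by tauto⟩
    by_cases hz2 : z = b
    · subst hz2
      exact ⟨a, fun y => ⟨fun h => ⟨h, hza.trans h⟩, And.left⟩, by tauto⟩
    obtain ⟨i, hi, hia⟩ := cs.exists_cover hza hz1
    obtain ⟨j, hj, hjb⟩ := cs.exists_cover hzb hz2
    have hia' := (cs.cover_subset_iff hi).2 ⟨hza, hia⟩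
    have hjb' := (cs.cover_subset_iff hj).2 ⟨hzb, hjb⟩
    obtain ⟨c, hc, hck⟩ := cs.exists_join_covers hi hj (hia'.trans hau) (hjb'.trans hbu)
    have hcu := (hc u).2 ⟨hia'.trans hau, hjb'.trans hbu⟩
    have hc1 := (hc c).1 subset_rfl
    obtain ⟨d, hd, hdk⟩ := ih (z := z * cs.simple i) (a := a) (b := c)
      (by rw [cs.length_cover hi]; omega) hia' hc1.1 hau hcu
    have hd1 := (hd d).1 subset_rfl
    obtain ⟨e, he, hek⟩ := ih (z := z * cs.simple j) (a := d) (b := b)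
      (by rw [cs.length_cover hj]; omega) (hc1.2.trans hd1.2) hjb' ((hd u).2 ⟨hau, hcu⟩) hbu
    refine ⟨e, fun y => ?_, fun k hka hkb => ?_⟩
    · rw [he, hd, hc]
      exact ⟨fun h => ⟨h.1.1, h.2⟩, fun h => ⟨⟨h.1, hia'.trans h.1, hjb'.trans h.2⟩, h.2⟩⟩
    · exact hek k (hdk k hka (hck k (fun h => hka (hia' h)) fun h => hkb (hjb' h))) hkb

/-- A set which contains `1` and the joins of its bounded pairs has a greatest element below each
`u`. -/
theorem exists_greatest_le {D : Set W} (h1 : 1 ∈ D)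
    (hD : ∀ a ∈ D, ∀ b ∈ D, ∀ c, cs.IsJoin {a, b} c → c ∈ D) (u : W) :
    ∃ m ∈ D, cs.inversions m ⊆ cs.inversions u ∧
      ∀ d ∈ D, cs.inversions d ⊆ cs.inversions u → cs.inversions d ⊆ cs.inversions m := by
  obtain ⟨m, ⟨hmD, hmu⟩, hmax⟩ := (measure fun d => cs.length u - cs.length d).wf.has_min
    {d | d ∈ D ∧ cs.inversions d ⊆ cs.inversions u} ⟨1, h1, by simp⟩
  refine ⟨m, hmD, hmu, fun d hd hdu => ?_⟩
  obtain ⟨c, hc, -⟩ := cs.exists_join_pair_of_le (z := 1) (cs.length u) (by simp) (by simp)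
    (by simp) hmu hdu
  have hcm := (hc c).1 subset_rfl
  have hcu := (hc u).2 ⟨hmu, hdu⟩
  have hcD : c ∈ D := hD m hmD d hd c fun y => by simp [hc]
  have h2 := hmax c ⟨hcD, hcu⟩
  have h3 : ¬ (cs.length u - cs.length c < cs.length u - cs.length m) := h2
  have h4 := cs.length_le_of_inversions_subset hcu
  have h5 := cs.length_le_of_inversions_subset hcm.1
  obtain rfl := cs.eq_of_subset_of_length_le hcm.1 (by omega)
  exact hcm.2

theorem exists_isMeet {X : Set W} (hX : X.Nonempty) : ∃ m, cs.IsMeet X m := by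
  obtain ⟨x₀, hx₀⟩ := hX
  obtain ⟨m, hmD, -, hm⟩ := cs.exists_greatest_le
    (D := {d | ∀ x ∈ X, cs.inversions d ⊆ cs.inversions x}) (by simp)
    (fun a ha b hb c hc x hx => (hc x).2 (by
      rintro y (rfl | rfl)
      · exact ha x hx
      · exact hb x hx)) x₀
  exact ⟨m, fun z => ⟨fun h x hx => h.trans (hmD x hx), fun h => hm z h (h x₀ hx₀)⟩⟩

theorem exists_isJoin {X : Set W} {u : W} (hu : ∀ x ∈ X, cs.inversions x ⊆ cs.inversions u) :
    ∃ j, cs.IsJoin X j := by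
  obtain ⟨j, hj⟩ := cs.exists_isMeet (X := {y | ∀ x ∈ X, cs.inversions x ⊆ cs.inversions y})
    ⟨u, hu⟩
  refine ⟨j, fun z => ⟨fun h x hx => ?_, fun h => hj.subset h⟩⟩
  exact ((hj x).2 fun y hy => hy x hx).trans h

/-- Join orthogonality for a simple reflection `s`: the elements without `s` as an inversion
are closed under bounded binary joins, hence under all existing joins. -/
theorem simple_notMem_join {X : Set W} {j : W} (hj : cs.IsJoin X j) {i : B}
    (hX : ∀ x ∈ X, cs.simple i ∉ cs.inversions x) : cs.simple i ∉ cs.inversions j := by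
  obtain ⟨m, hmD, hmj, hm⟩ := cs.exists_greatest_le
    (D := {d | cs.simple i ∉ cs.inversions d}) (by simp) (fun a ha b hb c hc => by
      obtain ⟨c', hc', hk⟩ := cs.exists_join_pair_of_le (z := 1) (cs.length c) (by simp)
        (by simp) (by simp) (hc.subset (Or.inl rfl)) (hc.subset (Or.inr rfl))
      obtain rfl : c = c' := hc.unique fun y => by simp [hc']
      exact hk i ha hb) j
  exact fun h => hmD ((hj m).2 (fun x hx => hm x (hX x hx) (hj.subset hx)) h)

/-- The join orthogonality property of a Coxeter group, by induction on the length of `y`: if `s` is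
an inversion of `y`, then left multiplication by `s` carries `X`, its join and `y` to a family, its
join and a shorter element. -/
theorem disjoint_join {X : Set W} {j y : W} (hj : cs.IsJoin X j)
    (hX : ∀ x ∈ X, Disjoint (cs.inversions x) (cs.inversions y)) :
    Disjoint (cs.inversions j) (cs.inversions y) := by
  induction hn : cs.length y generalizing X j y with
  | zero => rw [cs.length_eq_zero_iff.1 hn]; simp
  | succ n ih =>
    rcases X.eq_empty_or_nonempty with rfl | ⟨x₀, hx₀⟩
    · have := (hj 1).2 (by simp)
      rw [inversions_one, Set.subset_empty_iff] at this
      simp [this]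
    obtain ⟨i, hi⟩ := cs.exists_simple_mem_inversions (w := y) (by rintro rfl; simp at hn)
    have hXi : ∀ x ∈ X, cs.simple i ∉ cs.inversions x :=
      fun x hx h => Set.disjoint_left.1 (hX x hx) h hi
    have hji := cs.simple_notMem_join hj hXi
    rw [← cs.disjoint_simple_mul_iff hji hi]
    have hmem : ∀ {x z}, cs.simple i ∉ cs.inversions x →
        cs.inversions (cs.simple i * x) ⊆ cs.inversions z → cs.simple i ∈ cs.inversions z :=
      fun hx h => h (cs.simple_mem_inversions_simple_mul.2 hx)
    refine ih (X := (cs.simple i * ·) '' X) ?_ ?_ ?_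
    · intro z
      rw [Set.forall_mem_image]
      constructor
      · intro h x hx
        have hz := hmem hji h
        rw [cs.simple_mul_subset_iff hji hz, hj] at h
        exact (cs.simple_mul_subset_iff (hXi x hx) hz).2 (h x hx)
      · intro h
        have hz := hmem (hXi x₀ hx₀) (h hx₀)
        rw [cs.simple_mul_subset_iff hji hz, hj]
        exact fun x hx => (cs.simple_mul_subset_iff (hXi x hx) hz).1 (h hx)
    · rw [Set.forall_mem_image]
      exact fun x hx => (cs.disjoint_simple_mul_iff (hXi x hx) hi).2 (hX x hx)
    · have := cs.length_simple_mul y i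
      have := hi.2
      omega

end CoxeterSystem

/-! ### A criterion for Coxeter systems -/

/-- Every word in two involutions `a`, `b` is `(a b)ⁿ` or `(a b)ⁿ a`. -/
theorem mem_closure_pair_involutions {Q : Type*} [Group Q] {a b : Q} (ha : a * a = 1)
    (hb : b * b = 1) {x : Q} (hx : x ∈ Subgroup.closure {a, b}) :
    ∃ n : ℤ, x = (a * b) ^ n ∨ x = (a * b) ^ n * a := by
  have ha' : a⁻¹ = a := inv_eq_of_mul_eq_one_left ha
  have hb' : b⁻¹ = b := inv_eq_of_mul_eq_one_left hb
  have hba : b = a * (a * b) := by rw [← mul_assoc, ha, one_mul]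
  have conj : ∀ n : ℤ, a * (a * b) ^ n = (a * b) ^ (-n) * a := by
    intro n
    have h : a * (a * b) ^ n * a⁻¹ = ((a * b)⁻¹) ^ n := by
      rw [← conj_zpow]
      congr 1
      rw [← mul_assoc, ha, mul_inv_rev, ha', hb', one_mul]
    rw [zpow_neg, ← inv_zpow, ← h]
    group
  have hA : ∀ x, (∃ n : ℤ, x = (a * b) ^ n ∨ x = (a * b) ^ n * a) →
      ∃ n : ℤ, a * x = (a * b) ^ n ∨ a * x = (a * b) ^ n * a := by
    rintro x ⟨n, rfl | rfl⟩
    · exact ⟨-n, Or.inr (conj n)⟩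
    · exact ⟨-n, Or.inl (by rw [← mul_assoc, conj, mul_assoc, ha, mul_one])⟩
  have hB : ∀ x, (∃ n : ℤ, x = (a * b) ^ n ∨ x = (a * b) ^ n * a) →
      ∃ n : ℤ, b * x = (a * b) ^ n ∨ b * x = (a * b) ^ n * a := by
    rintro x ⟨n, rfl | rfl⟩
    · have := hA ((a * b) ^ (1 + n)) ⟨_, Or.inl rfl⟩
      rwa [zpow_add, zpow_one, ← mul_assoc, ← hba] at this
    · have := hA ((a * b) ^ (1 + n) * a) ⟨_, Or.inr rfl⟩
      rwa [zpow_add, zpow_one, mul_assoc (a * b), ← mul_assoc a (a * b), ← hba] at this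
  induction hx using Subgroup.closure_induction_left with
  | one => exact ⟨0, by simp⟩
  | mul_left x hx y _ ih =>
    rcases hx with rfl | rfl
    · exact hA _ ih
    · exact hB _ ih
  | inv_mul_cancel x hx y _ ih =>
    rcases hx with rfl | rfl
    · rw [ha']; exact hA _ ih
    · rw [hb']; exact hB _ ih

/-- A relation between two distinct involutions `r`, `r'` follows from `(r r')ᵐ = 1`, where `m` is
the order of `r r'`: a word in `(r, f)` and `(r', f')` with trivial first component is trivial. -/
theorem eq_one_of_mem_closure_pair {H P : Type*} [Group H] [Group P] {r r' : H} {f f' : P}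
    (hr : r * r = 1) (hr' : r' * r' = 1) (hr1 : r ≠ 1) (hr1' : r' ≠ 1)
    (hf : f * f = 1) (hf' : f' * f' = 1) (hff : (f * f') ^ orderOf (r * r') = 1)
    {p : P} (hp : ((1 : H), p) ∈ Subgroup.closure {(r, f), (r', f')}) : p = 1 := by
  have ha : (r, f) * (r, f) = 1 := by simp [hr, hf]
  have hb : (r', f') * (r', f') = 1 := by simp [hr', hf']
  obtain ⟨n, hn | hn⟩ := mem_closure_pair_involutions ha hb hp
  · rw [Prod.ext_iff] at hn
    simp only [Prod.pow_fst, Prod.pow_snd, Prod.mk_mul_mk] at hn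
    obtain ⟨k, rfl⟩ := orderOf_dvd_iff_zpow_eq_one.2 hn.1.symm
    rw [hn.2, zpow_mul, zpow_natCast, hff, one_zpow]
  · -- an odd word is conjugate to `r` or to `r'`, hence nontrivial
    exfalso
    rw [Prod.ext_iff] at hn
    have h1 : 1 = (r * r') ^ n * r := hn.1
    have hri : r⁻¹ = r := inv_eq_of_mul_eq_one_left hr
    have h2 : r = (r * r') ^ n := by
      have := eq_inv_of_mul_eq_one_left h1.symm
      rw [this, hri]
    have hc : Commute r (r * r') := by
      have := (Commute.refl (r * r')).zpow_left n
      rwa [← h2] at this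
    have hc' : r * r' = r' * r := by
      have h3 := hc.eq
      rw [mul_assoc r r' r] at h3
      exact mul_left_cancel h3
    have h4 : (r * r') ^ (2 : ℤ) = 1 := by
      rw [zpow_two]
      nth_rewrite 2 [hc']
      rw [mul_assoc, ← mul_assoc r' r' r, hr', one_mul, hr]
    rcases Int.even_or_odd' n with ⟨k, rfl | rfl⟩
    · rw [zpow_mul, h4, one_zpow] at h2
      exact hr1 h2
    · rw [zpow_add, zpow_mul, h4, one_zpow, one_mul, zpow_one] at h2
      exact hr1' (left_eq_mul.1 h2)

section Criterion

variable {H P : Type*} [Group H] [Group P] {S : Set H} (ℓ : H → ℕ) (f : S → P)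

/-- `LiftGraph ℓ f w p` says that `w = r₁ ⋯ rₙ` with `rᵢ ∈ S`, such that each letter increases the
length of the product of the letters to its right, and that `p = f r₁ ⋯ f rₙ`. -/
inductive LiftGraph : H → P → Prop
  | one : LiftGraph 1 1
  | mul (r : S) {w : H} {p : P} : LiftGraph w p → ℓ w < ℓ (r * w) → LiftGraph (r * w) (f r * p)

variable {ℓ f}

theorem liftGraph_of_descent (hS : ∀ r ∈ S, r * r = 1) {r : S} {w : H} (hw : ℓ (r * w) < ℓ w)
    {p : P} (h : LiftGraph ℓ f (r * w) p) : LiftGraph ℓ f w (f r * p) := by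
  have e : (r : H) * (r * w) = w := by rw [← mul_assoc, hS r r.2, one_mul]
  have := LiftGraph.mul r h (by rwa [e])
  rwa [e] at this

theorem exists_liftGraph (hS : ∀ r ∈ S, r * r = 1)
    (hdesc : ∀ w : H, w ≠ 1 → ∃ r : S, ℓ (r * w) < ℓ w) (w : H) : ∃ p, LiftGraph ℓ f w p := by
  induction hn : ℓ w using Nat.strong_induction_on generalizing w with
  | _ n ih =>
    by_cases hw : w = 1
    · exact ⟨1, hw ▸ .one⟩
    obtain ⟨r, hr⟩ := hdesc w hw
    obtain ⟨p, hp⟩ := ih _ (hn ▸ hr) _ rfl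
    exact ⟨_, liftGraph_of_descent hS hr hp⟩

/-- Peeling off descents in `{r, r'}` from the left, as long as there are any. -/
theorem exists_liftGraph_peel (hS : ∀ r ∈ S, r * r = 1)
    (hdesc : ∀ w : H, w ≠ 1 → ∃ r : S, ℓ (r * w) < ℓ w) (r r' : S) {n : ℕ}
    (huniq : ∀ w, ℓ w < n → ∀ p p', LiftGraph ℓ f w p → LiftGraph ℓ f w p' → p = p')
    {w : H} (hwn : ℓ w < n) {p : P} (hw : LiftGraph ℓ f w p) :
    ∃ d ∈ Subgroup.closure {((r : H), f r), ((r' : H), f r')}, ∃ y q, ℓ y < n ∧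
      LiftGraph ℓ f y q ∧ ¬ ℓ (r * y) < ℓ y ∧ ¬ ℓ (r' * y) < ℓ y ∧ (w, p) = d * (y, q) := by
  induction hk : ℓ w using Nat.strong_induction_on generalizing w p with
  | _ k ih =>
    have step : ∀ x : S, ((x : H), f x) ∈ ({((r : H), f r), ((r' : H), f r')} : Set (H × P)) →
        ℓ (x * w) < ℓ w →
        ∃ d ∈ Subgroup.closure {((r : H), f r), ((r' : H), f r')}, ∃ y q, ℓ y < n ∧
          LiftGraph ℓ f y q ∧ ¬ ℓ (r * y) < ℓ y ∧ ¬ ℓ (r' * y) < ℓ y ∧ (w, p) = d * (y, q) := by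
      intro x hx hxw
      obtain ⟨p₁, hp₁⟩ := exists_liftGraph (f := f) hS hdesc (x * w)
      obtain ⟨d, hd, y, q, hy, hyq, h1, h2, h3⟩ := ih _ (hk ▸ hxw) (hxw.trans hwn) hp₁ rfl
      refine ⟨_, mul_mem (Subgroup.subset_closure hx) hd, y, q, hy, hyq, h1, h2, ?_⟩
      rw [mul_assoc, ← h3, Prod.mk_mul_mk, ← mul_assoc, hS x x.2, one_mul,
        huniq w hwn p _ hw (liftGraph_of_descent hS hxw hp₁)]
    by_cases h1 : ℓ (r * w) < ℓ w
    · exact step r (Or.inl rfl) h1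
    by_cases h2 : ℓ (r' * w) < ℓ w
    · exact step r' (Or.inr rfl) h2
    exact ⟨1, one_mem _, w, p, hwn, hw, h1, h2, by simp⟩

/-- The graph `LiftGraph` is single-valued. Two decompositions of `w` which begin with `r` and `r'`
are compared by means of the minimal representative of the coset of `w` under the group generated by
`r` and `r'`, which is unique by hypothesis. -/
theorem LiftGraph.unique (hS : ∀ r ∈ S, r * r = 1) (hS1 : ∀ r ∈ S, r ≠ 1)
    (hdesc : ∀ w : H, w ≠ 1 → ∃ r : S, ℓ (r * w) < ℓ w)
    (hone : ∀ w : H, ℓ 1 ≤ ℓ w)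
    (hcoset : ∀ r ∈ S, ∀ r' ∈ S, ∀ d ∈ Subgroup.closure {r, r'}, ∀ y : H,
      ¬ ℓ (r * y) < ℓ y → ¬ ℓ (r' * y) < ℓ y → ¬ ℓ (r * (d * y)) < ℓ (d * y) →
      ¬ ℓ (r' * (d * y)) < ℓ (d * y) → d = 1)
    (hf : ∀ r r' : S, (f r * f r') ^ orderOf (r * r' : H) = 1) {w : H} {p p' : P}
    (h : LiftGraph ℓ f w p) (h' : LiftGraph ℓ f w p') : p = p' := by
  induction hn : ℓ w using Nat.strong_induction_on generalizing w p p' with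
  | _ n ih =>
    have huniq : ∀ w, ℓ w < n → ∀ p p', LiftGraph ℓ f w p → LiftGraph ℓ f w p' → p = p' :=
      fun w hw p p' h h' => ih _ hw h h' rfl
    have hf1 : ∀ r : S, f r * f r = 1 := by
      intro r
      have := hf r r
      rwa [hS r r.2, orderOf_one, pow_one] at this
    have mul_ne : ∀ (r : S) (v : H), ℓ v < ℓ (r * v) → (1 : H) ≠ r * v := by
      intro r v hv h
      rw [← h] at hv
      exact absurd hv (not_lt.2 (hone v))
    generalize hww : w = w' at h'
    cases h with
    | one =>
      cases h' with
      | one => rfl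
      | mul r' _ hl' => exact absurd hww (mul_ne _ _ hl')
    | @mul r w₁ p₁ h₁ hl =>
      cases h' with
      | one => exact absurd hww.symm (mul_ne _ _ hl)
      | @mul r' w₁' p₁' h₁' hl' =>
        obtain ⟨d, hd, y, q, hy, hyq, hy1, hy2, e⟩ :=
          exists_liftGraph_peel hS hdesc r r' huniq (hn ▸ hl) h₁
        obtain ⟨d', hd', y', q', hy', hyq', hy1', hy2', e'⟩ :=
          exists_liftGraph_peel hS hdesc r r' huniq (hn ▸ hww ▸ hl') h₁'
        set Γ := Subgroup.closure {((r : H), f r), ((r' : H), f r')} with hΓ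
        set c := ((r : H), f r) * d with hc
        set c' := ((r' : H), f r') * d' with hc'
        have hcΓ : c ∈ Γ := mul_mem (Subgroup.subset_closure (Or.inl rfl)) hd
        have hcΓ' : c' ∈ Γ := mul_mem (Subgroup.subset_closure (Or.inr rfl)) hd'
        have e1 : ((r : H) * w₁, f r * p₁) = c * (y, q) := by
          rw [hc, mul_assoc, ← e, Prod.mk_mul_mk]
        have e1' : ((r' : H) * w₁', f r' * p₁') = c' * (y', q') := by
          rw [hc', mul_assoc, ← e', Prod.mk_mul_mk]
        obtain ⟨e2, e3⟩ := Prod.ext_iff.1 e1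
        obtain ⟨e2', e3'⟩ := Prod.ext_iff.1 e1'
        simp only [Prod.fst_mul, Prod.snd_mul] at e2 e3 e2' e3'
        have hb : c'⁻¹ * c ∈ Γ := mul_mem (inv_mem hcΓ') hcΓ
        have hyy : y' = (c'⁻¹ * c).1 * y := by
          rw [Prod.fst_mul, Prod.fst_inv, mul_assoc, ← e2, hww, e2', inv_mul_cancel_left]
        have hfst : (c'⁻¹ * c).1 ∈ Subgroup.closure {(r : H), (r' : H)} := by
          have := Subgroup.mem_map_of_mem (MonoidHom.fst H P) hb
          rwa [hΓ, MonoidHom.map_closure, Set.image_pair] at this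
        have h1 : (c'⁻¹ * c).1 = 1 :=
          hcoset r r.2 r' r'.2 _ hfst y hy1 hy2 (hyy ▸ hy1') (hyy ▸ hy2')
        have h2 : (c'⁻¹ * c).2 = 1 := by
          refine eq_one_of_mem_closure_pair (hS r r.2) (hS r' r'.2) (hS1 r r.2) (hS1 r' r'.2)
            (hf1 r) (hf1 r') (hf r r') (p := (c'⁻¹ * c).2) ?_
          rw [← h1]; exact hb
        rw [h1, one_mul] at hyy
        subst hyy
        rw [e3, e3', huniq _ hy _ _ hyq hyq']
        rw [Prod.snd_mul, Prod.snd_inv, inv_mul_eq_one] at h2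
        rw [h2]

/-- Let `S` be a set of involutions of a group `H` and `ℓ` a function on `H`, minimal at `1`, which
changes under left multiplication by elements of `S` and such that every nontrivial element has a
descent in `S`. Then `(H, S)` is a Coxeter system as soon as, for all `r, r' ∈ S`, the cosets of the
group
generated by `r` and `r'` have at most one element without descents in `{r, r'}`. -/
theorem exists_coxeterSystem {H : Type*} [Group H] {S : Set H} (ℓ : H → ℕ)
    (hS : ∀ r ∈ S, r * r = 1) (hne : ∀ r ∈ S, ∀ w, ℓ (r * w) ≠ ℓ w)
    (hdesc : ∀ w : H, w ≠ 1 → ∃ r : S, ℓ (r * w) < ℓ w) (hone : ∀ w : H, ℓ 1 ≤ ℓ w)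
    (hcoset : ∀ r ∈ S, ∀ r' ∈ S, ∀ d ∈ Subgroup.closure {r, r'}, ∀ y : H,
      ¬ ℓ (r * y) < ℓ y → ¬ ℓ (r' * y) < ℓ y → ¬ ℓ (r * (d * y)) < ℓ (d * y) →
      ¬ ℓ (r' * (d * y)) < ℓ (d * y) → d = 1) :
    ∃ (M : CoxeterMatrix S) (cs : CoxeterSystem M H), ∀ s : S, cs.simple s = s := by
  have hS1 : ∀ r ∈ S, r ≠ 1 := by
    rintro r hr rfl
    exact hne 1 hr 1 (by rw [mul_one])
  let M : CoxeterMatrix S :=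
    { M := Matrix.of fun r r' => orderOf (r * r' : H)
      isSymm := by
        ext r r'
        change orderOf (r' * r : H) = orderOf (r * r' : H)
        rw [← orderOf_inv, mul_inv_rev, inv_eq_of_mul_eq_one_left (hS r r.2),
          inv_eq_of_mul_eq_one_left (hS r' r'.2)]
      diagonal := fun r => by
        change orderOf (r * r : H) = 1
        rw [hS r r.2, orderOf_one]
      off_diagonal := fun r r' hrr h => by
        change orderOf (r * r' : H) = 1 at h
        rw [orderOf_eq_one_iff] at h
        refine hrr (Subtype.ext ?_)
        rw [eq_inv_of_mul_eq_one_left h, inv_eq_of_mul_eq_one_left (hS r' r'.2)] }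
  let cP := M.toCoxeterSystem
  let φ : M.Group →* H := cP.lift ⟨fun r => r, fun r r' => pow_orderOf_eq_one _⟩
  have hφ : ∀ r : S, φ (cP.simple r) = r := fun r => cP.lift_apply_simple _ r
  let f : S → M.Group := cP.simple
  have hf : ∀ r r' : S, (f r * f r') ^ orderOf (r * r' : H) = 1 :=
    fun r r' => cP.simple_mul_simple_pow r r'
  have graph : ∀ p : M.Group, LiftGraph ℓ f (φ p) p := by
    intro p
    induction p using cP.simple_induction_left with
    | one => rw [map_one]; exact .one
    | mul_simple_left p r ih =>
      rw [map_mul, hφ]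
      rcases lt_or_gt_of_ne (hne r r.2 (φ p)) with h | h
      · obtain ⟨q, hq⟩ := exists_liftGraph (f := f) hS hdesc (r * φ p)
        have h1 := (liftGraph_of_descent hS h hq).unique hS hS1 hdesc hone hcoset hf ih
        have h2 : q = cP.simple r * p := by
          rw [← h1]; exact (cP.simple_mul_simple_cancel_left r).symm
        exact h2 ▸ hq
      · exact .mul r ih h
  have hinj : Function.Injective φ := by
    rw [injective_iff_map_eq_one]
    intro p hp
    have h := graph p
    rw [hp] at h
    exact h.unique hS hS1 hdesc hone hcoset hf .one
  have hsurj : Function.Surjective φ := by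
    intro w
    induction hn : ℓ w using Nat.strong_induction_on generalizing w with
    | _ n ih =>
      by_cases hw : w = 1
      · exact ⟨1, by rw [hw, map_one]⟩
      obtain ⟨r, hr⟩ := hdesc w hw
      obtain ⟨p, hp⟩ := ih _ (hn ▸ hr) _ rfl
      exact ⟨cP.simple r * p, by rw [map_mul, hφ, hp, ← mul_assoc, hS r r.2, one_mul]⟩
  exact ⟨M, cP.map (MulEquiv.ofBijective φ ⟨hinj, hsurj⟩), fun s => hφ s⟩

end Criterion

namespace CoxeterSystem

variable {B W : Type*} [Group W] {M : CoxeterMatrix B} (cs : CoxeterSystem M W)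

/-! ### Longest elements of standard parabolic subgroups as joins -/

section Parabolic

variable {J : Set W} (hJ : J ⊆ Set.range cs.simple)
include hJ

theorem inversions_subset_iff_of_mem {x z : W} (hx : x ∈ J) :
    cs.inversions x ⊆ cs.inversions z ↔ x ∈ cs.inversions z := by
  obtain ⟨i, rfl⟩ := hJ hx
  rw [inversions_simple, Set.singleton_subset_iff]

/-- An element of `W_J` which has all of `J` as inversions is the join of `J`. -/
theorem isJoin_of_subset_inversions {w : W} (hw : w ∈ Subgroup.closure J)
    (hJw : J ⊆ cs.inversions w) : cs.IsJoin J w := by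
  intro z
  constructor
  · intro h x hx
    exact (cs.inversions_subset_iff_of_mem hJ hx).2 (h (hJw hx))
  · intro h t ht
    exact cs.mem_inversions_of_closure hJ
      (fun x hx => (cs.inversions_subset_iff_of_mem hJ hx).1 (h x hx)) ht.1
      (cs.inversions_subset_closure hJ hw ht)

variable {cs} {w : W} (hw : cs.IsJoin J w)
include hw

theorem IsJoin.subset_inversions : J ⊆ cs.inversions w := fun _ hx =>
  (cs.inversions_subset_iff_of_mem hJ hx).1 (hw.subset hx)

theorem IsJoin.mem_closure : w ∈ Subgroup.closure J := by
  obtain ⟨v, hv, hvw⟩ := cs.exists_mem_closure_inversions_eq hJ w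
  have h : J ⊆ cs.inversions v := by
    rw [hvw]
    exact Set.subset_inter (hw.subset_inversions hJ) Subgroup.subset_closure
  rwa [hw.unique (cs.isJoin_of_subset_inversions hJ hv h)]

theorem IsJoin.mem_inversions_iff {t : W} :
    t ∈ cs.inversions w ↔ cs.IsReflection t ∧ t ∈ Subgroup.closure J :=
  ⟨fun h => ⟨h.1, cs.inversions_subset_closure hJ (hw.mem_closure hJ) h⟩,
    fun h => cs.mem_inversions_of_closure hJ (hw.subset_inversions hJ) h.1 h.2⟩

theorem IsJoin.inversions_subset_of_mem_closure {v : W} (hv : v ∈ Subgroup.closure J) :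
    cs.inversions v ⊆ cs.inversions w := fun _ ht =>
  (hw.mem_inversions_iff hJ).2 ⟨ht.1, cs.inversions_subset_closure hJ hv ht⟩

theorem IsJoin.mul_self : w * w = 1 := by
  have hwJ := hw.mem_closure hJ
  have h : w⁻¹ = w := cs.eq_of_subset_of_length_le
    (hw.inversions_subset_of_mem_closure hJ (inv_mem hwJ)) (by rw [length_inv])
  nth_rewrite 1 [← h]
  exact inv_mul_cancel w

theorem IsJoin.finite_closure : (Subgroup.closure J : Set W).Finite := by
  refine Set.Finite.of_finite_image (f := cs.inversions) ?_ cs.inversions_injective.injOn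
  refine (cs.finite_inversions w).finite_subsets.subset ?_
  rintro _ ⟨v, hv, rfl⟩
  exact hw.inversions_subset_of_mem_closure hJ hv

end Parabolic

/-! ### Diagram automorphisms and their fixed points -/

section DiagramAut

variable {cs} {σ : MulAut W}

theorem IsDiagramAut.inv (hσ : cs.IsDiagramAut σ) : cs.IsDiagramAut σ⁻¹ := by
  have h : (σ⁻¹ : MulAut W) '' (σ '' Set.range cs.simple) = Set.range cs.simple := by
    rw [Set.image_image]
    simp
  rwa [hσ] at h

theorem IsDiagramAut.length_le (hσ : cs.IsDiagramAut σ) (w : W) :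
    cs.length (σ w) ≤ cs.length w := by
  have h : ∀ i, ∃ j, cs.simple j = σ (cs.simple i) := fun i => by
    have := Set.mem_image_of_mem σ (Set.mem_range_self (f := cs.simple) i)
    rwa [hσ] at this
  choose g hg using h
  obtain ⟨ω, hω, rfl⟩ := cs.exists_isReduced w
  have e : σ (cs.wordProd ω) = cs.wordProd (ω.map g) := by
    simp only [wordProd, map_list_prod, List.map_map]
    congr 2
    funext i
    exact (hg i).symm
  rw [e, hω.eq]
  exact (cs.length_wordProd_le _).trans (by simp)

theorem IsDiagramAut.length_eq (hσ : cs.IsDiagramAut σ) (w : W) :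
    cs.length (σ w) = cs.length w := by
  refine (hσ.length_le w).antisymm ?_
  simpa using hσ.inv.length_le (σ w)

theorem IsDiagramAut.isReflection (hσ : cs.IsDiagramAut σ) {t : W} (ht : cs.IsReflection t) :
    cs.IsReflection (σ t) := by
  obtain ⟨w, i, rfl⟩ := ht
  obtain ⟨j, hj⟩ : σ (cs.simple i) ∈ Set.range cs.simple :=
    hσ ▸ Set.mem_image_of_mem σ (Set.mem_range_self i)
  exact ⟨σ w, j, by simp [hj]⟩

theorem IsDiagramAut.map_mem_inversions (hσ : cs.IsDiagramAut σ) {w t : W}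
    (ht : t ∈ cs.inversions w) : σ t ∈ cs.inversions (σ w) := by
  refine ⟨hσ.isReflection ht.1, ?_⟩
  rw [← map_mul, hσ.length_eq, hσ.length_eq]
  exact ht.2

theorem IsDiagramAut.inversions_map (hσ : cs.IsDiagramAut σ) (w : W) :
    cs.inversions (σ w) = σ '' cs.inversions w := by
  ext t
  constructor
  · intro h
    exact ⟨σ⁻¹ t, by simpa using hσ.inv.map_mem_inversions h, by simp⟩
  · rintro ⟨t, ht, rfl⟩
    exact hσ.map_mem_inversions ht

theorem IsDiagramAut.inversions_map_subset_iff (hσ : cs.IsDiagramAut σ) {x y : W} :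
    cs.inversions (σ x) ⊆ cs.inversions (σ y) ↔ cs.inversions x ⊆ cs.inversions y := by
  rw [hσ.inversions_map, hσ.inversions_map, Set.image_subset_image_iff σ.injective]

variable {G : Subgroup (MulAut W)}

theorem mem_fixedPoints_iff {w : W} :
    w ∈ FixedPoints.subgroup G W ↔ ∀ σ ∈ G, σ w = w :=
  ⟨fun h σ hσ => h ⟨σ, hσ⟩, fun h σ => h σ σ.2⟩

/-- Left multiplication by an involution which is below `w` or orthogonal to `w` changes the length
of `w`, and shortens it exactly in the former case. -/
theorem length_mul_lt_iff_of_mul_self {r w : W} (hrr : r * r = 1) (hr1 : r ≠ 1)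
    (h : cs.inversions r ⊆ cs.inversions w ∨ Disjoint (cs.inversions r) (cs.inversions w)) :
    cs.length (r * w) ≠ cs.length w ∧
      (cs.length (r * w) < cs.length w ↔ cs.inversions r ⊆ cs.inversions w) := by
  have hr : cs.length r ≠ 0 := fun h => hr1 (cs.length_eq_zero_iff.1 h)
  have hri : r⁻¹ = r := inv_eq_of_mul_eq_one_left hrr
  rcases h with h | h
  · have := cs.length_inv_mul_of_subset h
    rw [hri] at this
    exact ⟨by omega, fun _ => h, fun _ => by omega⟩
  · have := cs.length_inv_mul_of_disjoint h
    rw [hri] at this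
    refine ⟨by omega, fun _ => by omega, fun h2 => ?_⟩
    have h3 : cs.inversions r = ∅ := by simpa using h.mono_right h2
    rw [← ncard_inversions, h3, Set.ncard_empty] at hr
    exact absurd rfl hr

variable (hG : ∀ σ ∈ G, cs.IsDiagramAut σ)
include hG

theorem IsJoin.mem_fixedPoints {X : Set W} (hX : ∀ σ ∈ G, ∀ x ∈ X, σ x ∈ X) {j : W}
    (hj : cs.IsJoin X j) : j ∈ FixedPoints.subgroup G W := by
  have key : ∀ σ ∈ G, cs.inversions j ⊆ cs.inversions (σ j) := by
    intro σ hσ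
    rw [hj]
    intro x hx
    have h1 := hj.subset (hX _ (inv_mem hσ) x hx)
    rw [← (hG σ hσ).inversions_map_subset_iff] at h1
    simpa using h1
  exact mem_fixedPoints_iff.2 fun σ hσ =>
    (cs.eq_of_subset_of_length_le (key σ hσ) ((hG σ hσ).length_eq j).le).symm

theorem IsMeet.mem_fixedPoints {X : Set W} (hX : ∀ σ ∈ G, ∀ x ∈ X, σ x ∈ X) {j : W}
    (hj : cs.IsMeet X j) : j ∈ FixedPoints.subgroup G W := by
  have key : ∀ σ ∈ G, cs.inversions (σ j) ⊆ cs.inversions j := by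
    intro σ hσ
    rw [hj]
    intro x hx
    have h1 := hj.subset (hX _ (inv_mem hσ) x hx)
    rw [← (hG σ hσ).inversions_map_subset_iff] at h1
    simpa using h1
  exact mem_fixedPoints_iff.2 fun σ hσ =>
    cs.eq_of_subset_of_length_le (key σ hσ) ((hG σ hσ).length_eq j).ge

theorem forall_orbit_subset_iff {w v : W} (hv : v ∈ FixedPoints.subgroup G W) :
    (∀ x ∈ MulAction.orbit G w, cs.inversions x ⊆ cs.inversions v) ↔
      cs.inversions w ⊆ cs.inversions v := by
  refine ⟨fun h => h w (MulAction.mem_orbit_self w), ?_⟩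
  rintro h _ ⟨σ, rfl⟩
  have := (hG σ σ.2).inversions_map_subset_iff.2 h
  rwa [mem_fixedPoints_iff.1 hv σ σ.2] at this

/-- The join of the orbit of `w` exists as soon as `w` is below a fixed point. -/
theorem exists_isJoin_orbit {w v : W} (hv : v ∈ FixedPoints.subgroup G W)
    (h : cs.inversions w ⊆ cs.inversions v) :
    ∃ u ∈ FixedPoints.subgroup G W, cs.IsJoin (MulAction.orbit G w) u := by
  obtain ⟨u, hu⟩ := cs.exists_isJoin ((forall_orbit_subset_iff hG hv).2 h)
  refine ⟨u, hu.mem_fixedPoints hG ?_, hu⟩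
  exact fun σ hσ x hx => MulAction.mapsTo_smul_orbit (⟨σ, hσ⟩ : G) w hx

theorem IsJoin.orbit_subset_iff {w u v : W} (hu : cs.IsJoin (MulAction.orbit G w) u)
    (hv : v ∈ FixedPoints.subgroup G W) :
    cs.inversions u ⊆ cs.inversions v ↔ cs.inversions w ⊆ cs.inversions v := by
  rw [hu, forall_orbit_subset_iff hG hv]

theorem IsJoin.orbit_disjoint {w u v : W} (hu : cs.IsJoin (MulAction.orbit G w) u)
    (hv : v ∈ FixedPoints.subgroup G W) (h : Disjoint (cs.inversions w) (cs.inversions v)) :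
    Disjoint (cs.inversions u) (cs.inversions v) := by
  refine cs.disjoint_join hu ?_
  rintro _ ⟨σ, rfl⟩
  have h1 := (Set.disjoint_image_iff (σ : MulAut W).injective).2 h
  rw [← (hG σ σ.2).inversions_map, ← (hG σ σ.2).inversions_map,
    mem_fixedPoints_iff.1 hv σ σ.2] at h1
  exact h1

theorem orbit_subset_range_simple (i : B) :
    MulAction.orbit G (cs.simple i) ⊆ Set.range cs.simple := by
  rintro _ ⟨σ, rfl⟩
  have := Set.mem_image_of_mem (σ : MulAut W) (Set.mem_range_self (f := cs.simple) i)
  rwa [hG σ σ.2] at this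

/-- A fixed point is either above the join of an orbit of simple reflections or orthogonal to it. -/
theorem IsJoin.subset_or_disjoint {i : B} {r g : W}
    (hr : cs.IsJoin (MulAction.orbit G (cs.simple i)) r) (hg : g ∈ FixedPoints.subgroup G W) :
    cs.inversions r ⊆ cs.inversions g ∨ Disjoint (cs.inversions r) (cs.inversions g) := by
  by_cases h : cs.simple i ∈ cs.inversions g
  · refine Or.inl ((hr.orbit_subset_iff hG hg).2 ?_)
    rwa [inversions_simple, Set.singleton_subset_iff]
  · refine Or.inr (hr.orbit_disjoint hG hg ?_)
    rwa [inversions_simple, Set.disjoint_singleton_left]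

theorem mem_orbitLongestElements_iff {w : W} :
    w ∈ cs.orbitLongestElements G ↔ ∃ i, cs.IsJoin (MulAction.orbit G (cs.simple i)) w := by
  constructor
  · rintro ⟨_, ⟨i, rfl⟩, -, hw, hmax⟩
    have hJ := orbit_subset_range_simple hG i
    refine ⟨i, cs.isJoin_of_subset_inversions hJ hw fun x hx => ?_⟩
    obtain ⟨j, rfl⟩ := hJ hx
    exact ⟨cs.isReflection_simple j, lt_of_le_of_ne
      (hmax _ (mul_mem (Subgroup.subset_closure hx) hw)) (cs.length_simple_mul_ne w j)⟩
  · rintro ⟨i, hi⟩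
    have hJ := orbit_subset_range_simple hG i
    exact ⟨_, ⟨i, rfl⟩, hi.finite_closure hJ, hi.mem_closure hJ, fun v hv =>
      cs.length_le_of_inversions_subset (hi.inversions_subset_of_mem_closure hJ hv)⟩

theorem IsJoin.orbit_ne_one {i : B} {r : W}
    (hr : cs.IsJoin (MulAction.orbit G (cs.simple i)) r) : r ≠ 1 := by
  rintro rfl
  simpa using hr.subset_inversions (orbit_subset_range_simple hG i) (MulAction.mem_orbit_self _)

/-- A nontrivial fixed point is above the join of some orbit of simple reflections. -/
theorem exists_isJoin_orbit_simple {w : W} (hw : w ∈ FixedPoints.subgroup G W) (hw1 : w ≠ 1) :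
    ∃ i, ∃ r ∈ FixedPoints.subgroup G W, cs.IsJoin (MulAction.orbit G (cs.simple i)) r ∧
      cs.inversions r ⊆ cs.inversions w := by
  obtain ⟨i, hi⟩ := cs.exists_simple_mem_inversions hw1
  have hi' : cs.inversions (cs.simple i) ⊆ cs.inversions w := by
    rwa [inversions_simple, Set.singleton_subset_iff]
  obtain ⟨r, hr, hrj⟩ := exists_isJoin_orbit hG hw hi'
  exact ⟨i, r, hr, hrj, (hrj.orbit_subset_iff hG hw).2 hi'⟩

/-- The joins of orbits of simple reflections are minimal among the nontrivial fixed points: any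
simple reflection below such a join belongs to the orbit, by join orthogonality. -/
theorem IsJoin.orbit_minimal {i : B} {r v : W}
    (hr : cs.IsJoin (MulAction.orbit G (cs.simple i)) r)
    (hv : v ∈ FixedPoints.subgroup G W) (hv1 : v ≠ 1)
    (hvr : cs.inversions v ⊆ cs.inversions r) : cs.inversions r ⊆ cs.inversions v := by
  refine (hr.subset_or_disjoint hG hv).resolve_right fun h => ?_
  obtain ⟨j, hj⟩ := cs.exists_simple_mem_inversions hv1
  exact Set.disjoint_left.1 h (hvr hj) hj

theorem IsJoin.orbit_descent {i : B} {r w : W}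
    (hr : cs.IsJoin (MulAction.orbit G (cs.simple i)) r) (hw : w ∈ FixedPoints.subgroup G W) :
    cs.length (r * w) ≠ cs.length w ∧
      (cs.length (r * w) < cs.length w ↔ cs.inversions r ⊆ cs.inversions w) :=
  length_mul_lt_iff_of_mul_self (hr.mul_self (orbit_subset_range_simple hG i))
    (hr.orbit_ne_one hG) (hr.subset_or_disjoint hG hw)

/-- Tits' theorem: the fixed points of a group of diagram automorphisms form a Coxeter group, whose
simple reflections are the longest elements of the finite `W_J`, `J` an orbit. -/
theorem exists_coxeterSystem_fixedPoints :
    ∃ (M' : CoxeterMatrix {x : FixedPoints.subgroup G W | (x : W) ∈ cs.orbitLongestElements G})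
      (cs' : CoxeterSystem M' (FixedPoints.subgroup G W)), ∀ s, cs'.simple s = s := by
  refine exists_coxeterSystem (fun w => cs.length (w : W)) ?_ ?_ ?_ (by simp) ?_
  · rintro r hr
    obtain ⟨i, hi⟩ := (mem_orbitLongestElements_iff hG).1 hr
    exact Subtype.ext (hi.mul_self (orbit_subset_range_simple hG i))
  · rintro r hr w
    obtain ⟨i, hi⟩ := (mem_orbitLongestElements_iff hG).1 hr
    exact (hi.orbit_descent hG w.2).1
  · intro w hw
    obtain ⟨i, r, hr, hri, hrw⟩ := exists_isJoin_orbit_simple hG w.2 (by simpa using hw)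
    exact ⟨⟨⟨r, hr⟩, (mem_orbitLongestElements_iff hG).2 ⟨i, hri⟩⟩,
      (hri.orbit_descent hG w.2).2.2 hrw⟩
  · -- an element without descents `r = w_J`, `r' = w_J'` is minimal in its coset modulo `W_K`,
    -- where `K` is the union of `J` and `J'`
    intro r hr r' hr' d hd y h1 h2 h3 h4
    obtain ⟨i, hi⟩ := (mem_orbitLongestElements_iff hG).1 hr
    obtain ⟨i', hi'⟩ := (mem_orbitLongestElements_iff hG).1 hr'
    have hJ := orbit_subset_range_simple hG i
    have hJ' := orbit_subset_range_simple hG i'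
    set K := MulAction.orbit G (cs.simple i) ∪ MulAction.orbit G (cs.simple i') with hKdef
    have hK : K ⊆ Set.range cs.simple := Set.union_subset hJ hJ'
    have hdK : (d : W) ∈ Subgroup.closure K := by
      have hle : Subgroup.closure {r, r'} ≤
          (Subgroup.closure K).comap (FixedPoints.subgroup G W).subtype := by
        rw [Subgroup.closure_le]
        rintro x (rfl | rfl)
        · exact Subgroup.closure_mono Set.subset_union_left (hi.mem_closure hJ)
        · exact Subgroup.closure_mono Set.subset_union_right (hi'.mem_closure hJ')
      exact hle hd
    have hmin : ∀ z : FixedPoints.subgroup G W, ¬ cs.length ((r * z : W)) < cs.length (z : W) →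
        ¬ cs.length ((r' * z : W)) < cs.length (z : W) → ∀ e ∈ Subgroup.closure K,
        Disjoint (cs.inversions e) (cs.inversions (z : W)) := by
      intro z hz hz' e he
      have hd1 := (hi.subset_or_disjoint hG z.2).resolve_left
        fun h => hz ((hi.orbit_descent hG z.2).2.2 h)
      have hd2 := (hi'.subset_or_disjoint hG z.2).resolve_left
        fun h => hz' ((hi'.orbit_descent hG z.2).2.2 h)
      refine Set.disjoint_left.2 fun t ht => cs.notMem_inversions_of_closure hK ?_
        (cs.inversions_subset_closure hK he ht)
      exact Set.disjoint_union_left.2 ⟨hd1.mono_left (hi.subset_inversions hJ),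
        hd2.mono_left (hi'.subset_inversions hJ')⟩
    have e1 := cs.length_inv_mul_of_disjoint (hmin y h1 h2 _ (inv_mem hdK))
    have e2 := cs.length_inv_mul_of_disjoint (hmin (d * y) h3 h4 _ hdK)
    rw [inv_inv, length_inv] at e1
    rw [Subgroup.coe_mul, inv_mul_cancel_left] at e2
    exact Subtype.ext (cs.length_eq_zero_iff.1 (by omega))

end DiagramAut

end CoxeterSystem

namespace CoxeterSystem

open Protorootoid

variable {B W : Type*} [Group W] {M : CoxeterMatrix B} (cs : CoxeterSystem M W)

/-! ### The standard protorootoid and its restrictions to subgroups -/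

theorem inversionSet_subset_iff {x y : W} :
    cs.inversionSet x ⊆ cs.inversionSet y ↔ cs.inversions x ⊆ cs.inversions y :=
  ⟨fun h t ht => ⟨ht.1, @h ⟨t, ht.1⟩ ht.2⟩, fun h t ht => (h ⟨t.2, ht⟩).2⟩

theorem inversionSet_inter_eq_empty_iff {x y : W} :
    cs.inversionSet x ∩ cs.inversionSet y = ∅ ↔
      Disjoint (cs.inversions x) (cs.inversions y) := by
  rw [Set.disjoint_left, Set.eq_empty_iff_forall_notMem]
  exact ⟨fun h t hx hy => h ⟨t, hx.1⟩ ⟨hx.2, hy.2⟩, fun h t ht => h ⟨t.2, ht.1⟩ ⟨t.2, ht.2⟩⟩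

theorem elt_le_elt_iff {x y : W} :
    cs.standardProtorootoid.elt x ≤ cs.standardProtorootoid.elt y ↔
      cs.inversions x ⊆ cs.inversions y := by
  rw [← inversionSet_subset_iff, ← Set.inter_eq_left]
  exact Iff.rfl

theorem elt_orthogonal_iff {x y : W} :
    (cs.standardProtorootoid.elt x).N * (cs.standardProtorootoid.elt y).N = 0 ↔
      Disjoint (cs.inversions x) (cs.inversions y) := by
  rw [← inversionSet_inter_eq_empty_iff]
  exact Iff.rfl

theorem isLUB_elt_iff {X : Set (cs.standardProtorootoid.Star (SingleObj.star W))} {j : W} :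
    IsLUB X (cs.standardProtorootoid.elt j) ↔
      cs.IsJoin {x | cs.standardProtorootoid.elt x ∈ X} j := by
  rw [isLUB_iff_le_iff]
  constructor
  · intro h z
    rw [← elt_le_elt_iff, h]
    exact ⟨fun h x hx => cs.elt_le_elt_iff.1 (h hx), fun h x hx => cs.elt_le_elt_iff.2 (h _ hx)⟩
  · intro h z
    refine (cs.elt_le_elt_iff (y := z.2)).trans ((h _).trans ?_)
    exact ⟨fun h x hx => cs.elt_le_elt_iff.2 (h _ hx), fun h x hx => cs.elt_le_elt_iff.1 (h hx)⟩

theorem isGLB_elt_iff {X : Set (cs.standardProtorootoid.Star (SingleObj.star W))} {j : W} :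
    IsGLB X (cs.standardProtorootoid.elt j) ↔
      cs.IsMeet {x | cs.standardProtorootoid.elt x ∈ X} j := by
  rw [isGLB_iff_le_iff]
  constructor
  · intro h z
    rw [← elt_le_elt_iff, h]
    exact ⟨fun h x hx => cs.elt_le_elt_iff.1 (h hx), fun h x hx => cs.elt_le_elt_iff.2 (h _ hx)⟩
  · intro h z
    refine (cs.elt_le_elt_iff (x := z.2)).trans ((h _).trans ?_)
    exact ⟨fun h x hx => cs.elt_le_elt_iff.2 (h _ hx), fun h x hx => cs.elt_le_elt_iff.1 (h hx)⟩

theorem isRootoid_standardProtorootoid : cs.standardProtorootoid.IsRootoid where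
  faithful := by
    rintro a ⟨b, x⟩ hx
    have h1 : cs.inversions x ⊆ cs.inversions 1 := by
      rw [← inversionSet_subset_iff]
      have : cs.inversionSet x = ∅ := hx
      rw [this]
      exact Set.empty_subset _
    have h2 : (x : W) = 1 := cs.inversions_injective (h1.antisymm (by simp))
    exact congrArg cs.standardProtorootoid.elt h2
  exists_meet := by
    intro a X hX
    obtain ⟨x₀, hx₀⟩ := hX
    obtain ⟨m, hm⟩ := cs.exists_isMeet (X := {x | cs.standardProtorootoid.elt x ∈ X})
      ⟨x₀.2, hx₀⟩
    exact ⟨_, cs.isGLB_elt_iff.2 hm⟩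
  jop := by
    intro a X x y hx hX
    refine (cs.elt_orthogonal_iff (x := x.2) (y := y.2)).2 ?_
    refine cs.disjoint_join (cs.isLUB_elt_iff.1 hx) fun z hz => ?_
    exact cs.elt_orthogonal_iff.1 (hX _ hz)

section Restrict

variable {W' : Subgroup W}

theorem restrict_elt_le_iff {x y : W'} :
    (cs.standardProtorootoid.restrict W').elt x ≤ (cs.standardProtorootoid.restrict W').elt y ↔
      cs.inversions (x : W) ⊆ cs.inversions (y : W) :=
  cs.elt_le_elt_iff

theorem isFaithful_restrict : (cs.standardProtorootoid.restrict W').IsFaithful := by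
  rintro a ⟨b, x⟩ hx
  have h1 : cs.standardProtorootoid.elt ((show W' from x) : W) = ⊥ :=
    cs.isRootoid_standardProtorootoid.faithful (SingleObj.star W) _ hx
  have h2 : ((show W' from x) : W) = 1 := congrArg (fun z => (z.2 : W)) h1
  have h3 : (show W' from x) = 1 := Subtype.ext h2
  exact congrArg (cs.standardProtorootoid.restrict W').elt h3

theorem isIntervalFinite_restrict :
    (cs.standardProtorootoid.restrict W').IsIntervalFinite := by
  intro a x y
  let g : (cs.standardProtorootoid.restrict W').Star a → Set W :=
    fun z => cs.inversions ((show W' from z.2) : W)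
  have hg : Function.Injective g := by
    intro z z' h
    have : (show W' from z.2) = (show W' from z'.2) := Subtype.ext (cs.inversions_injective h)
    exact congrArg (cs.standardProtorootoid.restrict W').elt this
  refine Set.Finite.of_finite_image (f := g) ?_ hg.injOn
  refine (cs.finite_inversions ((show W' from y.2) : W)).finite_subsets.subset ?_
  rintro _ ⟨z, hz, rfl⟩
  exact cs.elt_le_elt_iff.1 hz.2

theorem restrictHom_star_injective (a : SingleObj W') :
    Function.Injective ((cs.standardProtorootoid.restrictHom W').star (a := a)) := by
  intro z z' h
  have h1 : ((show W' from z.2) : W) = ((show W' from z'.2) : W) :=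
    congrArg (fun x => (x.2 : W)) h
  have h2 : (show W' from z.2) = (show W' from z'.2) := Subtype.ext h1
  exact congrArg (cs.standardProtorootoid.restrict W').elt h2

theorem isPerp_iff {w : W} {r : W'} :
    (cs.standardProtorootoid.restrictHom W').IsPerp (a := SingleObj.star W')
        (cs.standardProtorootoid.elt w) ((cs.standardProtorootoid.restrict W').elt r) ↔
      cs.inversions w ⊆ cs.inversions (r : W) ∧
        ∀ v : W', cs.inversions w ⊆ cs.inversions (v : W) →
          cs.inversions (r : W) ⊆ cs.inversions (v : W) := by
  refine and_congr cs.elt_le_elt_iff ⟨fun h v hv => ?_, fun h v hv => ?_⟩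
  · exact cs.restrict_elt_le_iff.1
      (@h ((cs.standardProtorootoid.restrict W').elt v) (cs.elt_le_elt_iff.2 hv))
  · exact cs.restrict_elt_le_iff.2 (h (show W' from v.2) (cs.elt_le_elt_iff.1 hv))

theorem mem_atomicGenerators_iff {r : W'} :
    r ∈ (cs.standardProtorootoid.restrict W').atomicGenerators ↔
      r ≠ 1 ∧ ∀ v : W', v ≠ 1 → cs.inversions (v : W) ⊆ cs.inversions (r : W) →
        cs.inversions (r : W) ⊆ cs.inversions (v : W) := by
  set T := cs.standardProtorootoid.restrict W'
  have hbot : ∀ v : W', T.elt v = ⊥ ↔ v = 1 := fun v =>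
    ⟨fun h => congrArg (fun z => (z.2 : W')) h, fun h => congrArg T.elt h⟩
  change T.elt r ≠ ⊥ ∧ _ ↔ _
  rw [Ne, hbot]
  refine and_congr_right fun _ => ⟨fun h v hv hvr => ?_, fun h v hv => ?_⟩
  · by_contra hn
    refine hv ((hbot v).1 (h (T.elt v) (lt_iff_le_not_ge.2 ⟨?_, ?_⟩)))
    · exact cs.restrict_elt_le_iff.2 hvr
    · exact fun h => hn (cs.restrict_elt_le_iff.1 h)
  · by_contra hn
    have hv1 : (show W' from v.2) ≠ 1 := fun h => hn ((hbot _).2 h)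
    have h1 := lt_iff_le_not_ge.1 hv
    exact h1.2 (cs.restrict_elt_le_iff.2 (h _ hv1 (cs.restrict_elt_le_iff.1 h1.1)))

end Restrict

/-! ### The restriction to the fixed subgroup of a group of diagram automorphisms -/

/-- The restriction of the standard protorootoid to the fixed subgroup of `G`. -/
abbrev fixedProtorootoid (G : Subgroup (MulAut W)) :
    Protorootoid (SingleObj (FixedPoints.subgroup G W)) :=
  cs.standardProtorootoid.restrict (FixedPoints.subgroup G W)

/-- The canonical morphism from the restriction to the fixed subgroup of `G`. -/
abbrev fixedHom (G : Subgroup (MulAut W)) :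
    Hom (cs.fixedProtorootoid G) cs.standardProtorootoid :=
  cs.standardProtorootoid.restrictHom (FixedPoints.subgroup G W)

section FixedPoints

variable {cs} {G : Subgroup (MulAut W)}

theorem isLUB_orbit_iff {w u : W} :
    IsLUB (Set.range fun σ : G => cs.standardProtorootoid.elt ((σ : MulAut W) w))
      (cs.standardProtorootoid.elt u) ↔
      cs.IsJoin (MulAction.orbit G w) u := by
  rw [isLUB_elt_iff]
  have : {x | cs.standardProtorootoid.elt x ∈
      Set.range fun σ : G => cs.standardProtorootoid.elt ((σ : MulAut W) w)} =
      MulAction.orbit G w := by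
    ext x
    exact ⟨fun ⟨σ, h⟩ => ⟨σ, congrArg (fun z => (z.2 : W)) h⟩,
      fun ⟨σ, h⟩ => ⟨σ, congrArg cs.standardProtorootoid.elt h⟩⟩
  rw [this]

theorem map_mem_of_mem_image_star {a : SingleObj (FixedPoints.subgroup G W)}
    (X : Set ((cs.fixedProtorootoid G).Star a)) (σ : MulAut W) (hσ : σ ∈ G) (x : W)
    (hx : cs.standardProtorootoid.elt x ∈ (cs.fixedHom G).star '' X) :
    cs.standardProtorootoid.elt (σ x) ∈ (cs.fixedHom G).star '' X := by
  obtain ⟨z, hz, he⟩ := hx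
  have h1 : ((show FixedPoints.subgroup G W from z.2) : W) = x := congrArg (fun x => (x.2 : W)) he
  have h2 : σ x = x := by
    rw [← h1]; exact mem_fixedPoints_iff.1 (show FixedPoints.subgroup G W from z.2).2 σ hσ
  rw [h2]
  exact ⟨z, hz, he⟩

variable (hG : ∀ σ ∈ G, cs.IsDiagramAut σ)
include hG

/-- The join in `W` of a set of fixed points is a fixed point. -/
theorem exists_star_eq_of_isLUB {a : SingleObj (FixedPoints.subgroup G W)}
    (X : Set ((cs.fixedProtorootoid G).Star a))
    (y : cs.standardProtorootoid.Star (SingleObj.star W))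
    (hy : IsLUB ((cs.fixedHom G).star '' X) y) :
    ∃ x : (cs.fixedProtorootoid G).Star a, (cs.fixedHom G).star x = y := by
  have h := (cs.isLUB_elt_iff (j := y.2)).1 hy
  exact ⟨(cs.fixedProtorootoid G).elt
    ⟨y.2, h.mem_fixedPoints hG (map_mem_of_mem_image_star X)⟩, rfl⟩

theorem exists_star_eq_of_isGLB {a : SingleObj (FixedPoints.subgroup G W)}
    (X : Set ((cs.fixedProtorootoid G).Star a))
    (y : cs.standardProtorootoid.Star (SingleObj.star W))
    (hy : IsGLB ((cs.fixedHom G).star '' X) y) :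
    ∃ x : (cs.fixedProtorootoid G).Star a, (cs.fixedHom G).star x = y := by
  have h := (cs.isGLB_elt_iff (j := y.2)).1 hy
  exact ⟨(cs.fixedProtorootoid G).elt
    ⟨y.2, h.mem_fixedPoints hG (map_mem_of_mem_image_star X)⟩, rfl⟩

/-- The inclusion of the fixed subgroup preserves joins. -/
theorem isLUB_image_star {a : SingleObj (FixedPoints.subgroup G W)}
    {X : Set ((cs.fixedProtorootoid G).Star a)}
    {x : (cs.fixedProtorootoid G).Star a} (hx : IsLUB X x) :
    IsLUB ((cs.fixedHom G).star '' X) ((cs.fixedHom G).star x) := by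
  obtain ⟨j, hj⟩ := cs.exists_isJoin
    (X := {z | cs.standardProtorootoid.elt z ∈ (cs.fixedHom G).star '' X})
    (u := (show FixedPoints.subgroup G W from x.2)) (by
      rintro z ⟨z', hz', he⟩
      exact cs.elt_le_elt_iff.1 (he ▸ hx.1 hz'))
  have hj' : IsLUB ((cs.fixedHom G).star '' X) (cs.standardProtorootoid.elt j) :=
    cs.isLUB_elt_iff.2 hj
  obtain ⟨y, hy⟩ := exists_star_eq_of_isLUB hG X _ hj'
  rw [← hy] at hj'
  have h1 : (cs.fixedHom G).star x ≤ (cs.fixedHom G).star y :=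
    hx.2 fun z hz => hj'.1 ⟨z, hz, rfl⟩
  have h2 : (cs.fixedHom G).star y ≤ (cs.fixedHom G).star x :=
    hj'.2 (by rintro _ ⟨z, hz, rfl⟩; exact hx.1 hz)
  exact ⟨fun z hz => (hj'.1 hz).trans h2, fun z hz => h1.trans (hj'.2 hz)⟩

theorem exists_isGLB_isGLB_image {a : SingleObj (FixedPoints.subgroup G W)}
    {X : Set ((cs.fixedProtorootoid G).Star a)} (hX : X.Nonempty) :
    ∃ x, IsGLB X x ∧ IsGLB ((cs.fixedHom G).star '' X) ((cs.fixedHom G).star x) := by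
  obtain ⟨m, hm⟩ := cs.isRootoid_standardProtorootoid.exists_meet (SingleObj.star W) _
    (hX.image (cs.fixedHom G).star)
  obtain ⟨y, rfl⟩ := exists_star_eq_of_isGLB hG X _ hm
  refine ⟨y, ⟨fun z hz => hm.1 ⟨z, hz, rfl⟩, fun z hz => ?_⟩, hm⟩
  have h : (cs.fixedHom G).star z ∈ lowerBounds ((cs.fixedHom G).star '' X) := by
    rintro _ ⟨x, hx, rfl⟩
    exact hz hx
  exact hm.2 h

theorem isRootoid_restrict_fixedPoints : (cs.fixedProtorootoid G).IsRootoid where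
  faithful := cs.isFaithful_restrict
  exists_meet a X hX := (exists_isGLB_isGLB_image hG hX).imp fun _ h => h.1
  jop a X x y hx hX := by
    refine cs.isRootoid_standardProtorootoid.jop (SingleObj.star W) _
      ((cs.fixedHom G).star x) ((cs.fixedHom G).star y) (isLUB_image_star hG hx) ?_
    rintro _ ⟨z, hz, rfl⟩
    exact hX z hz

/-- The join of the orbit of `w` is the value at `w` of the adjoint. -/
theorem IsJoin.isPerp {w : W} {u : FixedPoints.subgroup G W}
    (hu : cs.IsJoin (MulAction.orbit G w) u) :
    (cs.fixedHom G).IsPerp (a := SingleObj.star (FixedPoints.subgroup G W))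
      (cs.standardProtorootoid.elt w) ((cs.fixedProtorootoid G).elt u) :=
  cs.isPerp_iff.2 ⟨(hu.orbit_subset_iff hG u.2).1 subset_rfl,
    fun v hv => (hu.orbit_subset_iff hG v.2).2 hv⟩

theorem isJoin_of_isPerp {w : W} {u : FixedPoints.subgroup G W}
    (hu : (cs.fixedHom G).IsPerp (a := SingleObj.star (FixedPoints.subgroup G W))
      (cs.standardProtorootoid.elt w) ((cs.fixedProtorootoid G).elt u)) :
    cs.IsJoin (MulAction.orbit G w) (u : W) := by
  obtain ⟨h1, h2⟩ := cs.isPerp_iff.1 hu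
  obtain ⟨v, hv, hvj⟩ := exists_isJoin_orbit hG u.2 h1
  have e : (u : W) = v := cs.inversions_injective ((h2 ⟨v, hv⟩
    ((hvj.orbit_subset_iff hG hv).1 subset_rfl)).antisymm ((hvj.orbit_subset_iff hG u.2).2 h1))
  rwa [e]

theorem isRdE_restrictHom_fixedPoints : (cs.fixedHom G).IsRdE where
  source := isRootoid_restrict_fixedPoints hG
  target := cs.isRootoid_standardProtorootoid
  map_meet a X x hX hx := by
    obtain ⟨y, hy, hy'⟩ := exists_isGLB_isGLB_image hG hX
    have h1 : (cs.fixedHom G).star x ≤ (cs.fixedHom G).star y := hy.2 hx.1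
    have h2 : (cs.fixedHom G).star y ≤ (cs.fixedHom G).star x := hx.2 hy.1
    exact ⟨fun z hz => h1.trans (hy'.1 hz), fun z hz => (hy'.2 hz).trans h2⟩
  map_join a X x hx := isLUB_image_star hG hx
  aop a x u w hu h := by
    have hj : cs.IsJoin (MulAction.orbit G (w.2 : W))
        ((show FixedPoints.subgroup G W from u.2) : W) := isJoin_of_isPerp hG hu
    have h1 := (cs.elt_orthogonal_iff
      (x := ((show FixedPoints.subgroup G W from x.2) : W)) (y := w.2)).1 h
    exact cs.elt_orthogonal_iff.2
      (hj.orbit_disjoint hG (show FixedPoints.subgroup G W from x.2).2 h1.symm).symm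
  le_iff a x y := Iff.rfl
  injective := cs.restrictHom_star_injective
  join_closed a X y hy := exists_star_eq_of_isLUB hG X y hy

theorem mem_atomicGenerators_fixedPoints_iff {r : FixedPoints.subgroup G W} :
    r ∈ (cs.fixedProtorootoid G).atomicGenerators ↔
      ∃ i, cs.IsJoin (MulAction.orbit G (cs.simple i)) (r : W) := by
  rw [mem_atomicGenerators_iff]
  constructor
  · rintro ⟨h1, h2⟩
    obtain ⟨i, v, hv, hvj, hvr⟩ := exists_isJoin_orbit_simple hG r.2 (by simpa using h1)
    have hv1 : (⟨v, hv⟩ : FixedPoints.subgroup G W) ≠ 1 :=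
      fun h => hvj.orbit_ne_one hG (congrArg Subtype.val h)
    have e : (r : W) = v := cs.inversions_injective ((h2 ⟨v, hv⟩ hv1 hvr).antisymm hvr)
    exact ⟨i, e ▸ hvj⟩
  · rintro ⟨i, hi⟩
    exact ⟨fun h => hi.orbit_ne_one hG (congrArg Subtype.val h),
      fun v hv hvr => hi.orbit_minimal hG v.2 (by simpa using hv) hvr⟩

theorem isPreprincipal_restrict_fixedPoints : (cs.fixedProtorootoid G).IsPreprincipal where
  faithful := cs.isFaithful_restrict
  intervalFinite := cs.isIntervalFinite_restrict
  le_or_orthogonal {a b} r hr g := by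
    obtain ⟨i, hi⟩ := (mem_atomicGenerators_fixedPoints_iff hG (r := r)).1 hr
    exact (hi.subset_or_disjoint hG (show FixedPoints.subgroup G W from g.2).2).imp
      cs.elt_le_elt_iff.2
      cs.elt_orthogonal_iff.2

end FixedPoints

end CoxeterSystem

theorem proposition13p2 {B W : Type*} [Group W] {M : CoxeterMatrix B} (cs : CoxeterSystem M W)
    (G : Subgroup (MulAut W)) (hG : ∀ σ ∈ G, cs.IsDiagramAut σ) :
    let W' : Subgroup W := FixedPoints.subgroup G W
    let R := cs.standardProtorootoid
    let T := R.restrict W'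
    let f := R.restrictHom W'
    let S' : Set W' := {x | (x : W) ∈ cs.orbitLongestElements G}
    T.IsRootoid ∧ T.IsPreprincipal ∧ f.IsRdE ∧
    (∀ w : W, (∃ v : W', R.elt w ≤ R.elt (v : W)) →
      ∃ u : W', f.IsPerp (a := SingleObj.star W') (R.elt w) (T.elt u) ∧
        IsLUB (Set.range fun σ : G => R.elt ((σ : MulAut W) w)) (R.elt (u : W))) ∧
    T.atomicGenerators = {r : W' | ∃ s ∈ Set.range cs.simple,
      f.IsPerp (a := SingleObj.star W') (R.elt s) (T.elt r)} ∧
    T.atomicGenerators = S' ∧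
    ∃ (M' : CoxeterMatrix S') (cs' : CoxeterSystem M' W'), ∀ s : S', cs'.simple s = s := by
  intro W' R T f S'
  refine ⟨CoxeterSystem.isRootoid_restrict_fixedPoints hG,
    CoxeterSystem.isPreprincipal_restrict_fixedPoints hG,
    CoxeterSystem.isRdE_restrictHom_fixedPoints hG, ?_, ?_, ?_,
    CoxeterSystem.exists_coxeterSystem_fixedPoints hG⟩
  · rintro w ⟨v, hv⟩
    obtain ⟨u, hu, huj⟩ :=
      CoxeterSystem.exists_isJoin_orbit hG v.2 (cs.elt_le_elt_iff.1 hv)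
    exact ⟨⟨u, hu⟩, CoxeterSystem.IsJoin.isPerp hG (u := ⟨u, hu⟩) huj,
      (CoxeterSystem.isLUB_orbit_iff).2 huj⟩
  · ext r
    rw [CoxeterSystem.mem_atomicGenerators_fixedPoints_iff hG]
    constructor
    · rintro ⟨i, hi⟩
      exact ⟨_, ⟨i, rfl⟩, CoxeterSystem.IsJoin.isPerp hG hi⟩
    · rintro ⟨_, ⟨i, rfl⟩, hi⟩
      exact ⟨i, CoxeterSystem.isJoin_of_isPerp hG hi⟩
  · ext r
    rw [CoxeterSystem.mem_atomicGenerators_fixedPoints_iff hG]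
    exact (CoxeterSystem.mem_orbitLongestElements_iff hG).symm
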